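/- All Lie algebras are real and finite-dimensional. Let $\mathfrak l$ be a nilpotent Lie algebra with lower central series $\mathfrak l^1=\mathfrak l$, $\mathfrak l^{k+1}=[\mathfrak l,\mathfrak l^{k}]$, and put $\mathfrak l'=\mathfrak l^2$. A semi-simple orthogonal $\mathfrak l$-module $(\rho,\mathfrak a)$ is a finite-dimensional real vector space $\mathfrak a$ with a non-degenerate symmetric bilinear form $\langle\cdot,\cdot\rangle$ and a semi-simple representation $\rho$ of $\mathfrak l$ on $\mathfrak a$ by skew-symmetric operators. A quadratic 2-cocycle is a pair $(\alpha,\gamma)$ of an alternating 2-form $\alpha$ on $\mathfrak l$ with values in $\mathfrak a$ and an alternating real 3-form $\gamma$ on $\mathfrak l$ with $d\alpha=0$ and $d\gamma=\frac12\langle\alpha\wedge\alpha\rangle$ ($d$ is the Chevalley–Eilenberg differential). The pairs $(\tau,\sigma)$ of a linear map $\tau:\mathfrak l\to\mathfrak a$ and an alternating real 2-form $\sigma$ on $\mathfrak l$ act on them by $(\alpha,\gamma)(\tau,\sigma)=(\alpha+d\tau,\ \gamma+d\sigma+\langle(\alpha+\frac12 d\tau)\wedge\tau\rangle)$; the set of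 orbits is $\mathcal H^2_Q(\mathfrak l,\mathfrak a)$. Let $m\ge 0$ be such that $\mathfrak l^{m+2}=0$, and put $\mathfrak l_{(0)}=\mathfrak z(\mathfrak l)\cap\ker\rho$, $\mathfrak l_{(k)}=\mathfrak z(\mathfrak l)\cap\mathfrak l^{k+1}$ for $k\ge1$. A class in $\mathcal H^2_Q(\mathfrak l,\mathfrak a)$, represented by $(\alpha,\gamma)$ with $\alpha(\mathfrak l,\mathfrak l)\subset\mathfrak a^{\mathfrak l}$, is admissible if for all $0\le k\le m$: $(A_k)$ if $L_0\in\mathfrak l_{(k)}$ and there are $A_0\in\mathfrak a$ and $Z_0\in(\mathfrak l^{k+1})^*$ such that for all $L\in\mathfrak l$ one has $\alpha(L,L_0)=0$ and $\gamma(L,L_0,\cdot)=-\langle A_0,\alpha(L,\cdot)\rangle+\langle Z_0,[L,\cdot]\rangle$ on $\mathfrak l^{k+1}$, then $L_0=0$; $(B_k)$ the image under $\alpha$ of the kernel of the bracket map $\mathfrak l\otimes\mathfrak l^{k+1}\to\mathfrak l$ is a non-degenerate subspace of $\mathfrak a$. The nilpotent Lie algebra $\mathfrak l$ is called admissible if some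 semi-simple orthogonal $\mathfrak l$-module $\mathfrak a$ has an admissible class in $\mathcal H^2_Q(\mathfrak l,\mathfrak a)$. Define nilpotent Lie algebras by the non-zero brackets of basis vectors (up to skew-symmetry): $\mathfrak h(1)=\{[X_1,X_2]=Y\}$, $\mathfrak g_{4,1}=\{[X_1,Z]=Y,\ [X_1,X_2]=Z\}$, $\mathfrak g_{5,2}=\{[X_1,X_2]=Y,\ [X_1,X_3]=Z\}$, $\mathfrak g_{6,4}=\{[X_1,X_2]=Y,\ [X_1,X_3]=Z,\ [X_3,X_4]=Y\}$, $\mathfrak g_{6,5}=\{[X_1,X_2]=Y,\ [X_1,X_3]=Z,\ [X_2,X_4]=Z,\ [X_3,X_4]=-Y\}$, where the basis consists of the vectors that occur; $\mathbb R^k$ denotes the abelian Lie algebra of dimension $k\ge 0$. **Proposition.** If $\mathfrak l$ is an admissible nilpotent Lie algebra with $\dim\mathfrak l'=2$, then for some $k\ge0$ it is isomorphic to one of $$\mathfrak h(1)\oplus\mathfrak h(1)\oplus\mathbb R^k,\quad \mathfrak g_{4,1}\oplus\mathbb R^k,\quad \mathfrak g_{5,2}\oplus\mathbb R^k,\quad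 \mathfrak g_{6,4}\oplus\mathbb R^k,\quad \mathfrak g_{6,5}\oplus\mathbb R^k.$$ Moreover, for every $k\ge0$ all five of these Lie algebras are admissible. -/

import Mathlib

open scoped TensorProduct
open LieModule.Cohomology

namespace QuadLie

section Cohomology

variable (L : Type*) [LieRing L] [LieAlgebra ℝ L]
  (A : Type*) [AddCommGroup A] [Module ℝ A] [LieRingModule L A] [LieModule ℝ L A]

/-- `(A, B)` is a semi-simple orthogonal `L`-module: `A` is a finite-dimensional representation of
`L`, `B` is a (possibly indefinite) inner product on `A` for which `L` acts by skew-symmetric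
operators, and every submodule of `A` has an invariant complement. -/
structure IsSemisimpleOrthogonalModule (B : LinearMap.BilinForm ℝ A) : Prop where
  finiteDimensional : FiniteDimensional ℝ A
  symm : B.IsSymm
  nondegenerate : B.Nondegenerate
  skew : ∀ (x : L) (a b : A), B ⁅x, a⁆ b + B a ⁅x, b⁆ = 0
  semisimple : ComplementedLattice (LieSubmodule ℝ L A)

variable {L A}

/-- The product `⟨τ ∧ τ'⟩` of two `A`-valued 1-cochains, a real-valued 2-cochain. -/
def wedge₁₁ (B : LinearMap.BilinForm ℝ A) (τ τ' : oneCochain ℝ L A) : twoCochain ℝ L ℝ :=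
  ⟨B.compl₁₂ τ τ' - (B.compl₁₂ τ τ').flip, fun x => by simp⟩

/-- The product `⟨α ∧ τ⟩` of an `A`-valued 2-cochain and an `A`-valued 1-cochain. -/
def wedge₂₁ (B : LinearMap.BilinForm ℝ A) (α : twoCochain ℝ L A) (τ : oneCochain ℝ L A)
    (x y z : L) : ℝ :=
  B (α x y) (τ z) - B (α x z) (τ y) + B (α y z) (τ x)

/-- The product `⟨α ∧ β⟩` of two `A`-valued 2-cochains. -/
def wedge₂₂ (B : LinearMap.BilinForm ℝ A) (α β : twoCochain ℝ L A) (w x y z : L) : ℝ :=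
  B (α w x) (β y z) - B (α w y) (β x z) + B (α w z) (β x y)
    + B (α x y) (β w z) - B (α x z) (β w y) + B (α y z) (β w x)

/-- The coboundary of a real-valued 2-cochain (trivial coefficients). -/
def dTwo (σ : twoCochain ℝ L ℝ) (x y z : L) : ℝ :=
  -σ ⁅x, y⁆ z + σ ⁅x, z⁆ y - σ ⁅y, z⁆ x

/-- The coboundary of a real-valued 3-cochain (trivial coefficients). -/
def dThree (γ : L [⋀^Fin 3]→ₗ[ℝ] ℝ) (w x y z : L) : ℝ :=
  -γ ![⁅w, x⁆, y, z] + γ ![⁅w, y⁆, x, z] - γ ![⁅w, z⁆, x, y]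
    - γ ![⁅x, y⁆, w, z] + γ ![⁅x, z⁆, w, y] - γ ![⁅y, z⁆, w, x]

variable (L) in
/-- Quadratic 2-cocycles: pairs `(α, γ)` of a 2-cochain with values in `A` and a real-valued
3-cochain such that `dα = 0` and `dγ = ½ ⟨α ∧ α⟩`. -/
structure QuadCocycle (B : LinearMap.BilinForm ℝ A) where
  α : twoCochain ℝ L A
  γ : L [⋀^Fin 3]→ₗ[ℝ] ℝ
  d_α : d₂₃ ℝ L A α = 0
  d_γ : ∀ w x y z : L, dThree γ w x y z = (1 / 2 : ℝ) * wedge₂₂ B α α w x y z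

/-- Two quadratic cocycles are equivalent if they lie in the same orbit of the group of quadratic
1-cochains `(τ, σ)`, which acts by
`(α, γ)(τ, σ) = (α + dτ, γ + dσ + ⟨(α + ½ dτ) ∧ τ⟩)`. -/
def QuadCocycle.Equiv (B : LinearMap.BilinForm ℝ A) (c c' : QuadCocycle L B) : Prop :=
  ∃ (τ : oneCochain ℝ L A) (σ : twoCochain ℝ L ℝ),
    c'.α = c.α + d₁₂ ℝ L A τ ∧
    ∀ x y z : L, c'.γ ![x, y, z] = c.γ ![x, y, z] + dTwo σ x y z
      + wedge₂₁ B (c.α + (1 / 2 : ℝ) • d₁₂ ℝ L A τ) τ x y z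

variable {B : LinearMap.BilinForm ℝ A}

theorem QuadCocycle.Equiv.refl (c : QuadCocycle L B) : c.Equiv B c :=
  ⟨0, 0, by simp, fun x y z => by
    have h : ∀ x y : L, (0 : twoCochain ℝ L ℝ) x y = 0 := fun _ _ => rfl
    simp [dTwo, wedge₂₁, h]⟩

theorem QuadCocycle.Equiv.symm {c c' : QuadCocycle L B} (h : c.Equiv B c') : c'.Equiv B c := by
  obtain ⟨τ, σ, h₁, h₂⟩ := h
  have h₀ : ∀ x y : L, d₁₂ ℝ L A (-τ) x y = (-1 : ℝ) • d₁₂ ℝ L A τ x y := fun x y => by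
    simp only [d₁₂_apply_apply, LinearMap.neg_apply, lie_neg]; module
  have h₁' : c.α = c'.α + d₁₂ ℝ L A (-τ) := by
    rw [h₁]
    ext x y
    change c.α x y = (c.α x y + d₁₂ ℝ L A τ x y) + d₁₂ ℝ L A (-τ) x y
    rw [h₀]; module
  refine ⟨-τ, (-1 : ℝ) • σ, h₁', fun x y z => ?_⟩
  have h₃ : c'.α + (1 / 2 : ℝ) • d₁₂ ℝ L A (-τ) = c.α + (1 / 2 : ℝ) • d₁₂ ℝ L A τ := by
    rw [h₁]
    ext x y
    change (c.α x y + d₁₂ ℝ L A τ x y) + (1 / 2 : ℝ) • d₁₂ ℝ L A (-τ) x y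
      = c.α x y + (1 / 2 : ℝ) • d₁₂ ℝ L A τ x y
    rw [h₀]; module
  rw [h₂, h₃]
  simp only [dTwo, wedge₂₁, smul_apply_apply, LinearMap.neg_apply, map_neg, smul_eq_mul]
  ring

theorem QuadCocycle.Equiv.trans (hB : IsSemisimpleOrthogonalModule L A B)
    {c c' c'' : QuadCocycle L B} (h : c.Equiv B c') (h' : c'.Equiv B c'') : c.Equiv B c'' := by
  obtain ⟨τ, σ, h₁, h₂⟩ := h
  obtain ⟨τ', σ', h₁', h₂'⟩ := h'
  refine ⟨τ + τ', σ + σ' + (1 / 2 : ℝ) • wedge₁₁ B τ τ', by rw [h₁', h₁, map_add]; abel,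
    fun x y z => ?_⟩
  have hs : ∀ a b : A, B a b = B b a := hB.symm.eq
  have hk : ∀ (x : L) (a b : A), B a ⁅x, b⁆ = -B b ⁅x, a⁆ := fun x a b => by
    have := hB.skew x a b
    rw [hs ⁅x, a⁆ b] at this
    linarith
  have hw : ∀ x y : L, wedge₁₁ B τ τ' x y = B (τ x) (τ' y) - B (τ y) (τ' x) := fun x y => rfl
  rw [h₂', h₂, h₁]
  simp only [dTwo, wedge₂₁, add_apply_apply, smul_apply_apply, hw, map_add, map_smul,
    LinearMap.add_apply, LinearMap.smul_apply, smul_eq_mul, d₁₂_apply_apply, map_sub,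
    LinearMap.sub_apply]
  have e : ∀ (x : L) (a b : A), B ⁅x, a⁆ b = B b ⁅x, a⁆ := fun x a b => hs _ _
  simp only [e, hs (τ' ⁅x, y⁆), hs (τ' ⁅x, z⁆), hs (τ' ⁅y, z⁆), hs (τ ⁅x, y⁆) (τ' _),
    hs (τ ⁅x, z⁆) (τ' _), hs (τ ⁅y, z⁆) (τ' _), hk _ (τ' _) (τ _)]
  ring

/-- The equivalence relation of quadratic cocycles for an orthogonal module. -/
def quadSetoid (hB : IsSemisimpleOrthogonalModule L A B) : Setoid (QuadCocycle L B) where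
  r := QuadCocycle.Equiv B
  iseqv := ⟨QuadCocycle.Equiv.refl, QuadCocycle.Equiv.symm, QuadCocycle.Equiv.trans hB⟩

/-- The second quadratic cohomology set of `L` with coefficients in `(A, B)`. -/
def QuadCohomology (hB : IsSemisimpleOrthogonalModule L A B) : Type _ :=
  Quotient (quadSetoid hB)

/-! In Mathlib's indexing `lowerCentralSeries ℝ L L k` is the term `l^{k+1}` of the lower central
series `l^1 = l`, `l^{k+1} = [l, l^k]`. -/

variable (L A) in
/-- The ideals `l_(0) = z(l) ∩ ker ρ` and `l_(k) = z(l) ∩ l^{k+1}` for `k ≥ 1`. -/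
def centralPart : ℕ → LieIdeal ℝ L
  | 0 => LieAlgebra.center ℝ L ⊓ LieModule.ker ℝ L A
  | k + 1 => LieAlgebra.center ℝ L ⊓ LieModule.lowerCentralSeries ℝ L L (k + 1)

variable (L) in
/-- The bracket as a linear map `l ⊗ l^{k+1} → l`. -/
def bracketMap (k : ℕ) : L ⊗[ℝ] LieModule.lowerCentralSeries ℝ L L k →ₗ[ℝ] L :=
  TensorProduct.lift ((LieModule.toEnd ℝ L L : L →ₗ[ℝ] L →ₗ[ℝ] L).compl₂
    (LieModule.lowerCentralSeries ℝ L L k).toSubmodule.subtype)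

/-- A 2-cochain as a linear map `l ⊗ l^{k+1} → A`. -/
def cochainMap (α : twoCochain ℝ L A) (k : ℕ) :
    L ⊗[ℝ] LieModule.lowerCentralSeries ℝ L L k →ₗ[ℝ] A :=
  TensorProduct.lift ((α : L →ₗ[ℝ] L →ₗ[ℝ] A).compl₂
    (LieModule.lowerCentralSeries ℝ L L k).toSubmodule.subtype)

/-- Condition `(A_k)`. -/
def ConditionA (c : QuadCocycle L B) (k : ℕ) : Prop :=
  ∀ L₀ ∈ centralPart L A k,
    (∃ (A₀ : A) (Z₀ : Module.Dual ℝ (LieModule.lowerCentralSeries ℝ L L k)),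
      ∀ x : L, c.α x L₀ = 0 ∧
        ∀ y : LieModule.lowerCentralSeries ℝ L L k,
          c.γ ![x, L₀, (y : L)] = -B A₀ (c.α x (y : L)) + Z₀ ⁅x, y⁆) →
    L₀ = 0

/-- Condition `(B_k)`: the image under `α` of the kernel of `l ⊗ l^{k+1} → l` is a non-degenerate
subspace. -/
def ConditionB (c : QuadCocycle L B) (k : ℕ) : Prop :=
  (B.restrict ((LinearMap.ker (bracketMap L k)).map (cochainMap c.α k))).Nondegenerate

/-- Admissibility of a quadratic cohomology class of a nilpotent Lie algebra. It is tested on a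
representative `(α, γ)` for which `α` has values in the invariants of `A`, for all `0 ≤ k ≤ m`,
where `l^{m+2} = 0`. -/
def QuadCohomology.IsAdmissible (hB : IsSemisimpleOrthogonalModule L A B)
    (φ : QuadCohomology hB) : Prop :=
  ∃ c : QuadCocycle L B, Quotient.mk (quadSetoid hB) c = φ ∧
    (∀ x y : L, c.α x y ∈ LieModule.maxTrivSubmodule ℝ L A) ∧
    ∃ m : ℕ, LieModule.lowerCentralSeries ℝ L L (m + 1) = ⊥ ∧
      ∀ k ≤ m, ConditionA c k ∧ ConditionB c k

variable (L) in
/-- A nilpotent Lie algebra is admissible if there is a semi-simple orthogonal module for which an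
admissible quadratic cohomology class exists. (Non-nilpotent Lie algebras never satisfy this.) -/
def IsAdmissible : Prop :=
  ∃ (A : Type) (_ : AddCommGroup A) (_ : Module ℝ A) (_ : LieRingModule L A)
    (_ : LieModule ℝ L A) (B : LinearMap.BilinForm ℝ A)
    (hB : IsSemisimpleOrthogonalModule L A B) (φ : QuadCohomology hB), φ.IsAdmissible hB

end Cohomology

/-! ### The Lie algebras of the classification

Each of them is a coordinate space with the bracket written in coordinates with respect to the
named basis; all brackets of basis vectors that are not listed vanish. -/

/-- The Lie algebra `h(1)`, with basis `X₁, X₂, Y` and `[X₁, X₂] = Y`. -/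
def H1 : Type := Fin 3 → ℝ

instance : AddCommGroup H1 := inferInstanceAs (AddCommGroup (Fin 3 → ℝ))
instance : Module ℝ H1 := inferInstanceAs (Module ℝ (Fin 3 → ℝ))

/-- The Lie algebra `g_{4,1}`, with basis `X₁, X₂, Y, Z` and `[X₁, Z] = Y`, `[X₁, X₂] = Z`. -/
def G41 : Type := Fin 4 → ℝ

instance : AddCommGroup G41 := inferInstanceAs (AddCommGroup (Fin 4 → ℝ))
instance : Module ℝ G41 := inferInstanceAs (Module ℝ (Fin 4 → ℝ))

/-- The Lie algebra `g_{5,2}`, with basis `X₁, X₂, X₃, Y, Z` and `[X₁, X₂] = Y`,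
`[X₁, X₃] = Z`. -/
def G52 : Type := Fin 5 → ℝ

instance : AddCommGroup G52 := inferInstanceAs (AddCommGroup (Fin 5 → ℝ))
instance : Module ℝ G52 := inferInstanceAs (Module ℝ (Fin 5 → ℝ))

/-- The Lie algebra `g_{6,4}`, with basis `X₁, X₂, X₃, X₄, Y, Z` and `[X₁, X₂] = Y`,
`[X₁, X₃] = Z`, `[X₃, X₄] = Y`. -/
def G64 : Type := Fin 6 → ℝ

instance : AddCommGroup G64 := inferInstanceAs (AddCommGroup (Fin 6 → ℝ))
instance : Module ℝ G64 := inferInstanceAs (Module ℝ (Fin 6 → ℝ))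

/-- The Lie algebra `g_{6,5}`, with basis `X₁, X₂, X₃, X₄, Y, Z` and `[X₁, X₂] = Y`,
`[X₁, X₃] = Z`, `[X₂, X₄] = Z`, `[X₃, X₄] = -Y`. -/
def G65 : Type := Fin 6 → ℝ

instance : AddCommGroup G65 := inferInstanceAs (AddCommGroup (Fin 6 → ℝ))
instance : Module ℝ G65 := inferInstanceAs (Module ℝ (Fin 6 → ℝ))

/-- The abelian Lie algebra `ℝ^k`. -/
def Rab (k : ℕ) : Type := Fin k → ℝ

instance (k : ℕ) : AddCommGroup (Rab k) := inferInstanceAs (AddCommGroup (Fin k → ℝ))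
instance (k : ℕ) : Module ℝ (Rab k) := inferInstanceAs (Module ℝ (Fin k → ℝ))

/-- The `(i, j)` minor of two coordinate vectors. -/
def minor {n : ℕ} (i j : Fin n) (x y : Fin n → ℝ) : ℝ := x i * y j - x j * y i

/-- The bracket of `h(1)` in coordinates. -/
def H1.br (x y : Fin 3 → ℝ) : Fin 3 → ℝ := ![0, 0, minor 0 1 x y]

/-- The bracket of `g_{4,1}` in coordinates. -/
def G41.br (x y : Fin 4 → ℝ) : Fin 4 → ℝ := ![0, 0, minor 0 3 x y, minor 0 1 x y]

/-- The bracket of `g_{5,2}` in coordinates. -/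
def G52.br (x y : Fin 5 → ℝ) : Fin 5 → ℝ := ![0, 0, 0, minor 0 1 x y, minor 0 2 x y]

/-- The bracket of `g_{6,4}` in coordinates. -/
def G64.br (x y : Fin 6 → ℝ) : Fin 6 → ℝ :=
  ![0, 0, 0, 0, minor 0 1 x y + minor 2 3 x y, minor 0 2 x y]

/-- The bracket of `g_{6,5}` in coordinates. -/
def G65.br (x y : Fin 6 → ℝ) : Fin 6 → ℝ :=
  ![0, 0, 0, 0, minor 0 1 x y - minor 2 3 x y, minor 0 2 x y + minor 1 3 x y]

instance : LieRing H1 where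
  bracket x y := H1.br x y
  add_lie x y z := by
    change H1.br (fun i => x i + y i) z = fun i => H1.br x z i + H1.br y z i
    funext i; fin_cases i <;> simp [H1.br, minor]; ring
  lie_add x y z := by
    change H1.br x (fun i => y i + z i) = fun i => H1.br x y i + H1.br x z i
    funext i; fin_cases i <;> simp [H1.br, minor]; ring
  lie_self x := by
    change H1.br x x = fun _ => 0
    funext i; fin_cases i <;> simp [H1.br, minor]; ring
  leibniz_lie x y z := by
    change H1.br x (H1.br y z) = fun i => H1.br (H1.br x y) z i + H1.br y (H1.br x z) i
    funext i; fin_cases i <;> simp [H1.br, minor]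

instance : LieAlgebra ℝ H1 where
  lie_smul t x y := by
    change H1.br x (fun i => t * y i) = fun i => t * H1.br x y i
    funext i; fin_cases i <;> simp [H1.br, minor]; ring

instance : LieRing G41 where
  bracket x y := G41.br x y
  add_lie x y z := by
    change G41.br (fun i => x i + y i) z = fun i => G41.br x z i + G41.br y z i
    funext i; fin_cases i <;> simp [G41.br, minor] <;> ring
  lie_add x y z := by
    change G41.br x (fun i => y i + z i) = fun i => G41.br x y i + G41.br x z i
    funext i; fin_cases i <;> simp [G41.br, minor] <;> ring
  lie_self x := by
    change G41.br x x = fun _ => 0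
    funext i; fin_cases i <;> simp [G41.br, minor] <;> ring
  leibniz_lie x y z := by
    change G41.br x (G41.br y z) = fun i => G41.br (G41.br x y) z i + G41.br y (G41.br x z) i
    funext i; fin_cases i <;> simp [G41.br, minor]; ring

instance : LieAlgebra ℝ G41 where
  lie_smul t x y := by
    change G41.br x (fun i => t * y i) = fun i => t * G41.br x y i
    funext i; fin_cases i <;> simp [G41.br, minor] <;> ring

instance : LieRing G52 where
  bracket x y := G52.br x y
  add_lie x y z := by
    change G52.br (fun i => x i + y i) z = fun i => G52.br x z i + G52.br y z i
    funext i; fin_cases i <;> simp [G52.br, minor] <;> ring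
  lie_add x y z := by
    change G52.br x (fun i => y i + z i) = fun i => G52.br x y i + G52.br x z i
    funext i; fin_cases i <;> simp [G52.br, minor] <;> ring
  lie_self x := by
    change G52.br x x = fun _ => 0
    funext i; fin_cases i <;> simp [G52.br, minor] <;> ring
  leibniz_lie x y z := by
    change G52.br x (G52.br y z) = fun i => G52.br (G52.br x y) z i + G52.br y (G52.br x z) i
    funext i; fin_cases i <;> simp [G52.br, minor]

instance : LieAlgebra ℝ G52 where
  lie_smul t x y := by
    change G52.br x (fun i => t * y i) = fun i => t * G52.br x y i
    funext i; fin_cases i <;> simp [G52.br, minor] <;> ring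

instance : LieRing G64 where
  bracket x y := G64.br x y
  add_lie x y z := by
    change G64.br (fun i => x i + y i) z = fun i => G64.br x z i + G64.br y z i
    funext i; fin_cases i <;> simp [G64.br, minor] <;> ring
  lie_add x y z := by
    change G64.br x (fun i => y i + z i) = fun i => G64.br x y i + G64.br x z i
    funext i; fin_cases i <;> simp [G64.br, minor] <;> ring
  lie_self x := by
    change G64.br x x = fun _ => 0
    funext i; fin_cases i <;> simp [G64.br, minor] <;> ring
  leibniz_lie x y z := by
    change G64.br x (G64.br y z) = fun i => G64.br (G64.br x y) z i + G64.br y (G64.br x z) i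
    funext i; fin_cases i <;> simp [G64.br, minor]

instance : LieAlgebra ℝ G64 where
  lie_smul t x y := by
    change G64.br x (fun i => t * y i) = fun i => t * G64.br x y i
    funext i; fin_cases i <;> simp [G64.br, minor] <;> ring

instance : LieRing G65 where
  bracket x y := G65.br x y
  add_lie x y z := by
    change G65.br (fun i => x i + y i) z = fun i => G65.br x z i + G65.br y z i
    funext i; fin_cases i <;> simp [G65.br, minor] <;> ring
  lie_add x y z := by
    change G65.br x (fun i => y i + z i) = fun i => G65.br x y i + G65.br x z i
    funext i; fin_cases i <;> simp [G65.br, minor] <;> ring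
  lie_self x := by
    change G65.br x x = fun _ => 0
    funext i; fin_cases i <;> simp [G65.br, minor] <;> ring
  leibniz_lie x y z := by
    change G65.br x (G65.br y z) = fun i => G65.br (G65.br x y) z i + G65.br y (G65.br x z) i
    funext i; fin_cases i <;> simp [G65.br, minor]

instance : LieAlgebra ℝ G65 where
  lie_smul t x y := by
    change G65.br x (fun i => t * y i) = fun i => t * G65.br x y i
    funext i; fin_cases i <;> simp [G65.br, minor] <;> ring

instance (k : ℕ) : LieRing (Rab k) where
  bracket _ _ := 0
  add_lie _ _ _ := (add_zero 0).symm
  lie_add _ _ _ := (add_zero 0).symm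
  lie_self _ := rfl
  leibniz_lie _ _ _ := (add_zero 0).symm

instance (k : ℕ) : LieAlgebra ℝ (Rab k) where
  lie_smul t _ _ := (smul_zero t).symm

end QuadLie

/-
Fix linear coordinates `η, ζ` of the two-dimensional algebra `l'`, dual to a basis `Y, Z`. The
bracket of `l` is then the pair of alternating forms `η ⁅·,·⁆`, `ζ ⁅·,·⁆`, up to a change of
coordinates and up to an abelian summand.

Let `l` be two-step nilpotent and let `(α, γ)` represent an admissible class. If `α(Y, ·) = 0` for
some `Y ≠ 0` in `l'`, then `(A₁)` applied to the linear form `γ(·, Y, Z)` yields `g_{5,2}` or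
degenerations of it. Otherwise `dα = 0` says `η ⁅·,·⁆ ∧ α(Y, ·) + ζ ⁅·,·⁆ ∧ α(Z, ·) = 0`, and when
`α(Y, ·)`, `α(Z, ·)` have linearly independent scalar components `a`, `b`, Cartan's lemma gives
`η ⁅·,·⁆ = a ∧ p' + b ∧ p` and `ζ ⁅·,·⁆ = a ∧ p + b ∧ q`. If `a, b, p, p', q` are independent,
then `α(Y, ·)` and `α(Z, ·)` take values in a single line, which is isotropic by the equation for
`dγ`, contradicting `(B₁)`. A relation among them is, modulo `a` and `b`, a binary quadratic form,
and the sign of its discriminant decides between `h(1) ⊕ h(1)`, `g_{6,4}` and `g_{6,5}`. In the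
three-step case `(A₂)` and `(B₂)` force `α(Y, ·) = f ⊗ a` with `a` anisotropic, for `Y` spanning
`l³`, and then `l` is `g_{4,1}` up to an abelian summand.

Conversely, each of the five algebras carries a cocycle with trivial coefficients satisfying the
conditions. An abelian summand `ℝᵏ` is accommodated by letting it act faithfully by rotations on a
further summand `ℂᵏ` of the module, since `(A₀)` only concerns the kernel of `ρ`.
-/

open Module

namespace QuadLie

section WedgeProduct

variable {R V W : Type*} [CommRing R] [AddCommGroup V] [Module R V] [AddCommGroup W] [Module R W]

/-- The wedge product `f ∧ g` of two linear forms, as a bilinear form. -/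
def wedge (f g : Dual R V) : LinearMap.BilinForm R V := f.smulRight g - g.smulRight f

theorem wedge_apply (f g : Dual R V) (x y : V) : wedge f g x y = f x * g y - g x * f y := by
  simp [wedge, mul_comm]

theorem isAlt_wedge (f g : Dual R V) : (wedge f g).IsAlt := fun x => by
  rw [wedge_apply, mul_comm, sub_self]

theorem wedge_apply_eq_zero {f g : Dual R V} {x : V} (hf : f x = 0) (hg : g x = 0) :
    wedge f g x = 0 :=
  LinearMap.ext fun y => by rw [wedge_apply, hf, hg, zero_mul, zero_mul, sub_zero,
    LinearMap.zero_apply]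

/-- The wedge product `β ∧ C` of an alternating bilinear form and a vector-valued linear map, as a
trilinear expression. -/
def formWedge (β : LinearMap.BilinForm R V) (C : V →ₗ[R] W) (x y z : V) : W :=
  β x y • C z + β y z • C x + β z x • C y

theorem dual_comp_formWedge (φ : Dual R W) (β : LinearMap.BilinForm R V) (C : V →ₗ[R] W)
    (x y z : V) : formWedge β (φ ∘ₗ C) x y z = φ (formWedge β C x y z) := by
  simp only [formWedge, LinearMap.comp_apply, map_add, map_smul]

theorem eq_wedge_of_formWedge_eq_zero {β : LinearMap.BilinForm R V} (hβ : β.IsAlt)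
    {f : Dual R V} {x₀ : V} (hx₀ : f x₀ = 1) (h : ∀ x y z, formWedge β f x y z = 0) :
    β = wedge f (β x₀) := by
  refine LinearMap.ext₂ fun x y => ?_
  have hxy := h x y x₀
  simp only [formWedge, hx₀, smul_eq_mul] at hxy
  rw [wedge_apply]
  linear_combination hxy + f x * hβ.neg_eq x₀ y

theorem exists_eq_dotProduct_cross {β : LinearMap.BilinForm R (Fin 3 → R)} (hβ : β.IsAlt) :
    ∃ u : Fin 3 → R, ∀ x y, β x y = u ⬝ᵥ crossProduct x y := by
  let e (i : Fin 3) : Fin 3 → R := Pi.single i 1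
  refine ⟨![β (e 1) (e 2), β (e 2) (e 0), β (e 0) (e 1)], fun x y => ?_⟩
  have hx (x : Fin 3 → R) : x = x 0 • e 0 + x 1 • e 1 + x 2 • e 2 := by
    funext i; fin_cases i <;> simp [e]
  conv_lhs => rw [hx x, hx y]
  simp only [map_add, map_smul, LinearMap.add_apply, LinearMap.smul_apply, smul_eq_mul,
    hβ.self_eq_zero, ← hβ.neg_eq (e 0) (e 1), ← hβ.neg_eq (e 1) (e 2), ← hβ.neg_eq (e 2) (e 0),
    cross_apply, Matrix.vec3_dotProduct, Matrix.cons_val]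
  ring

open scoped Matrix in
theorem dotProduct_mul_triple_product (r s u v w : Fin 3 → R) :
    r ⬝ᵥ s * u ⬝ᵥ v ⨯₃ w =
      r ⬝ᵥ u * s ⬝ᵥ v ⨯₃ w + r ⬝ᵥ v * s ⬝ᵥ w ⨯₃ u + r ⬝ᵥ w * s ⬝ᵥ u ⨯₃ v := by
  simp only [cross_apply, Matrix.vec3_dotProduct, Matrix.cons_val]
  ring

theorem compLinearMap_apply_three (γ : V [⋀^Fin 3]→ₗ[R] R) (φ : W →ₗ[R] V) (x y z : W) :
    γ.compLinearMap φ ![x, y, z] = γ ![φ x, φ y, φ z] := by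
  rw [AlternatingMap.compLinearMap_apply]
  congr 1
  ext i
  fin_cases i <;> rfl

/-- The decomposable alternating 3-form `f ∧ g ∧ h`. -/
noncomputable def tripleWedge (f g h : Dual R V) : V [⋀^Fin 3]→ₗ[R] R :=
  (Matrix.detRowAlternating (n := Fin 3) (R := R)).compLinearMap (LinearMap.pi ![f, g, h])

theorem tripleWedge_apply (f g h : Dual R V) (x y z : V) : tripleWedge f g h ![x, y, z] =
      f x * wedge g h y z - g x * wedge f h y z + h x * wedge f g y z := by
  rw [tripleWedge, compLinearMap_apply_three]
  refine (Matrix.det_fin_three _).trans ?_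
  simp only [Matrix.cons_val, LinearMap.pi_apply, wedge_apply]
  ring

variable (γ : V [⋀^Fin 3]→ₗ[R] R)

/-- The linear form `x ↦ γ (x, y, z)`, the contraction of a three-form with two vectors. -/
def contractTwo (y z : V) : Dual R V where
  toFun x := γ ![x, y, z]
  map_add' _ _ := AlternatingMap.map_vecCons_add _ _ _ _
  map_smul' _ _ := AlternatingMap.map_vecCons_smul _ _ _ _

theorem contractTwo_apply (x y z : V) : contractTwo γ y z x = γ ![x, y, z] := rfl

theorem contractTwo_apply_left (y z : V) : contractTwo γ y z y = 0 :=
  γ.map_eq_zero_of_eq _ (i := 0) (j := 1) rfl zero_ne_one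

theorem contractTwo_apply_right (y z : V) : contractTwo γ y z z = 0 :=
  γ.map_eq_zero_of_eq _ (i := 0) (j := 2) rfl (by decide)

theorem contractTwo_left_comm (x y z : V) : contractTwo γ x z y = -contractTwo γ y z x := by
  rw [contractTwo_apply, contractTwo_apply, ← γ.map_swap _ (show (0 : Fin 3) ≠ 1 by decide)]
  congr 1
  funext i
  fin_cases i <;> rfl

theorem contractTwo_swap (y z : V) : contractTwo γ z y = -contractTwo γ y z :=
  LinearMap.ext fun x => by
    rw [LinearMap.neg_apply, contractTwo_apply, contractTwo_apply,
      ← γ.map_swap _ (show (1 : Fin 3) ≠ 2 by decide)]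
    congr 1
    funext i
    fin_cases i <;> rfl

end WedgeProduct

section LinearAlgebra

variable {K V W : Type*} [Field K] [AddCommGroup V] [Module K V] [AddCommGroup W] [Module K W]

theorem exists_forall_apply_eq {ι : Type*} [Finite ι] {F : ι → Dual K V}
    (hF : LinearIndependent K F) (v : ι → K) : ∃ x, ∀ i, F i x = v i := by
  have hF' : LinearIndependent K fun i => (F i : V → K) :=
    hF.map' (LinearMap.ltoFun K V K K)
      (LinearMap.ker_eq_bot.2 DFunLike.coe_injective)
  have hspan : Submodule.span K (Set.range (LinearMap.pi F)) = ⊤ :=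
    span_flip_eq_top_iff_linearIndependent.2 hF'
  have hv : v ∈ Submodule.span K (Set.range (LinearMap.pi F)) := hspan ▸ Submodule.mem_top
  rw [← LinearMap.coe_range, Submodule.span_eq] at hv
  obtain ⟨x, hx⟩ := hv
  exact ⟨x, congrFun hx⟩

theorem exists_succAbove_of_not_linearIndependent {n : ℕ} {F : Fin (n + 1) → Dual K V}
    (hF : ¬LinearIndependent K F) : ∃ k, ∀ x, (∀ i, F (Fin.succAbove k i) x = 0) → F k x = 0 := by
  obtain ⟨r, hr, k, hk⟩ := Fintype.not_linearIndependent_iff.1 hF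
  refine ⟨k, fun x hx => ?_⟩
  have hrx := LinearMap.congr_fun hr x
  simpa [Fin.sum_univ_succAbove _ k, hx, hk] using hrx

theorem linearIndependent_of_wedge_ne_zero {f g : Dual K V} (h : wedge f g ≠ 0) :
    LinearIndependent K ![f, g] := by
  have hf : f ≠ 0 := by rintro rfl; exact h (LinearMap.ext₂ fun x y => by simp [wedge_apply])
  refine (LinearIndependent.pair_iff' hf).2 fun c hc => h (LinearMap.ext₂ fun x y => ?_)
  rw [wedge_apply, ← hc]
  simp only [LinearMap.smul_apply, LinearMap.zero_apply, smul_eq_mul]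
  ring

theorem eq_zero_of_wedge_apply_eq_zero {f g : Dual K V} (hfg : LinearIndependent K ![f, g]) {u : V}
    (hu : wedge f g u = 0) : f u = 0 ∧ g u = 0 := by
  have := LinearIndependent.pair_iff.1 hfg (-g u) (f u) <| LinearMap.ext fun x => by
    have hx := LinearMap.congr_fun hu x
    simp only [wedge_apply, LinearMap.add_apply, LinearMap.smul_apply, LinearMap.zero_apply,
      smul_eq_mul] at hx ⊢
    linear_combination hx
  exact ⟨this.2, neg_eq_zero.1 this.1⟩

theorem eq_zero_of_wedge_add_wedge_apply_eq_zero {a p b q : Dual K V}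
    (hi : LinearIndependent K ![a, p, b, q]) {u : V} (hu : (wedge a p + wedge b q) u = 0) :
    ∀ i, ![a, p, b, q] i u = 0 := by
  have := Fintype.linearIndependent_iff.1 hi ![-p u, a u, -q u, b u] <| LinearMap.ext fun x => by
    have hx := LinearMap.congr_fun hu x
    simp only [LinearMap.add_apply, wedge_apply, LinearMap.zero_apply, Fin.sum_univ_four,
      Matrix.cons_val, LinearMap.smul_apply, smul_eq_mul] at hx ⊢
    linear_combination hx
  intro i
  fin_cases i
  exacts [this 1, neg_eq_zero.1 (this 0), this 3, neg_eq_zero.1 (this 2)]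

theorem exists_eq_wedge_add_wedge {β : LinearMap.BilinForm K V} (hβ : β.IsAlt) {a b : Dual K V}
    (hab : LinearIndependent K ![a, b])
    (h : ∀ x y, a x = 0 → b x = 0 → a y = 0 → b y = 0 → β x y = 0) :
    ∃ f g : Dual K V, β = wedge a f + wedge b g := by
  obtain ⟨x₁, hx₁⟩ := exists_forall_apply_eq hab ![1, 0]
  obtain ⟨x₂, hx₂⟩ := exists_forall_apply_eq hab ![0, 1]
  have a₁ : a x₁ = 1 := hx₁ 0
  have b₁ : b x₁ = 0 := hx₁ 1
  have a₂ : a x₂ = 0 := hx₂ 0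
  have b₂ : b x₂ = 1 := hx₂ 1
  refine ⟨β x₁, β x₂ + β x₁ x₂ • a, LinearMap.ext₂ fun x y => ?_⟩
  have hxy := h (x - a x • x₁ - b x • x₂) (y - a y • x₁ - b y • x₂) (by simp [a₁, a₂])
    (by simp [b₁, b₂]) (by simp [a₁, a₂]) (by simp [b₁, b₂])
  simp only [map_sub, map_smul, LinearMap.sub_apply, LinearMap.smul_apply, smul_eq_mul,
    hβ.self_eq_zero, ← hβ.neg_eq x₁, ← hβ.neg_eq x₂ x] at hxy
  simp only [LinearMap.add_apply, wedge_apply, LinearMap.smul_apply, smul_eq_mul]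
  linear_combination hxy

theorem exists_eq_smul_wedge {β : LinearMap.BilinForm K V} (hβ : β.IsAlt) {f g : Dual K V}
    (hfg : LinearIndependent K ![f, g]) (hf : ∀ x y z, formWedge β f x y z = 0)
    (hg : ∀ x y z, formWedge β g x y z = 0) : ∃ k : K, β = k • wedge f g := by
  obtain ⟨x₁, hx₁⟩ := exists_forall_apply_eq hfg ![1, 0]
  obtain ⟨x₂, hx₂⟩ := exists_forall_apply_eq hfg ![0, 1]
  have f₁ : f x₁ = 1 := hx₁ 0
  have g₁ : g x₁ = 0 := hx₁ 1
  have g₂ : g x₂ = 1 := hx₂ 1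
  have hβf := eq_wedge_of_formWedge_eq_zero hβ f₁ hf
  have hβg : ∀ y, β x₁ y = β x₁ x₂ * g y := fun y => by
    have := hg x₁ y x₂
    simp only [formWedge, g₁, g₂, smul_eq_mul] at this
    linear_combination this + g y * hβ.neg_eq x₁ x₂
  refine ⟨β x₁ x₂, LinearMap.ext₂ fun x y => ?_⟩
  nth_rw 1 [hβf]
  rw [wedge_apply, hβg x, hβg y, LinearMap.smul_apply, LinearMap.smul_apply, wedge_apply,
    smul_eq_mul]
  ring

/-- Cartan's lemma for two-forms. -/
theorem exists_eq_wedge_of_formWedge_add_eq_zero {β β' : LinearMap.BilinForm K V} (hβ : β.IsAlt)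
    (hβ' : β'.IsAlt) {a b : Dual K V} (hab : LinearIndependent K ![a, b])
    (h : ∀ x y z, formWedge β a x y z + formWedge β' b x y z = 0) :
    ∃ p p' q : Dual K V, β = wedge a p' + wedge b p ∧ β' = wedge a p + wedge b q := by
  obtain ⟨x₁, hx₁⟩ := exists_forall_apply_eq hab ![1, 0]
  obtain ⟨x₂, hx₂⟩ := exists_forall_apply_eq hab ![0, 1]
  have a₁ : a x₁ = 1 := hx₁ 0
  have b₁ : b x₁ = 0 := hx₁ 1
  have a₂ : a x₂ = 0 := hx₂ 0
  have b₂ : b x₂ = 1 := hx₂ 1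
  simp only [formWedge, smul_eq_mul] at h
  obtain ⟨p', p₀, hβ₀⟩ := exists_eq_wedge_add_wedge hβ hab fun x y ha hb ha' hb' => by
    simpa [a₁, b₁, ha, hb, ha', hb'] using h x y x₁
  obtain ⟨p, q₀, hβ₀'⟩ := exists_eq_wedge_add_wedge hβ' hab fun x y ha hb ha' hb' => by
    simpa [a₂, b₂, ha, hb, ha', hb'] using h x y x₂
  -- Substituting, the hypothesis becomes `a ∧ b ∧ (p - p₀) = 0`.
  have hp : ∀ z, p z - p₀ z = (p x₁ - p₀ x₁) * a z + (p x₂ - p₀ x₂) * b z := fun z => by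
    have := h x₁ x₂ z
    simp only [hβ₀, hβ₀', LinearMap.add_apply, wedge_apply, a₁, a₂, b₁, b₂] at this
    linear_combination -this
  refine ⟨p - (p x₁ - p₀ x₁) • a, p', q₀, LinearMap.ext₂ fun x y => ?_,
    LinearMap.ext₂ fun x y => ?_⟩
  all_goals
    simp only [hβ₀, hβ₀', LinearMap.add_apply, LinearMap.sub_apply, LinearMap.smul_apply,
      wedge_apply, smul_eq_mul]
  · linear_combination b y * hp x - b x * hp y
  · ring

theorem exists_eq_smulRight_add_smulRight_of_formWedge_wedge_eq_zero {f g : Dual K V}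
    (hfg : LinearIndependent K ![f, g]) {D : V →ₗ[K] W}
    (h : ∀ x y z, formWedge (wedge f g) D x y z = 0) :
    ∃ v w : W, D = f.smulRight v + g.smulRight w := by
  obtain ⟨x₁, hx₁⟩ := exists_forall_apply_eq hfg ![1, 0]
  obtain ⟨x₂, hx₂⟩ := exists_forall_apply_eq hfg ![0, 1]
  have f₁ : f x₁ = 1 := hx₁ 0
  have g₁ : g x₁ = 0 := hx₁ 1
  have f₂ : f x₂ = 0 := hx₂ 0
  have g₂ : g x₂ = 1 := hx₂ 1
  refine ⟨D x₁, D x₂, LinearMap.ext fun x => ?_⟩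
  have hx := h x₁ x₂ x
  simp only [formWedge, wedge_apply, f₁, f₂, g₁, g₂] at hx
  simp only [LinearMap.add_apply, LinearMap.smulRight_apply]
  linear_combination (norm := module) hx

theorem exists_eq_smulRight_of_formWedge_add_eq_zero {a b p p' q : Dual K V}
    (hi : LinearIndependent K ![a, b, p, p', q]) {C D : V →ₗ[K] W}
    (h : ∀ x y z, formWedge (wedge a p' + wedge b p) C x y z +
      formWedge (wedge a p + wedge b q) D x y z = 0) :
    ∃ s : W, C = a.smulRight s ∧ D = b.smulRight s := by
  choose e he using fun j => exists_forall_apply_eq hi (Pi.single j 1)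
  simp only [Pi.single_apply, Fin.forall_fin_succ, Matrix.cons_val_zero, Matrix.cons_val_succ,
    IsEmpty.forall_iff, and_true, Fin.reduceSucc, Fin.reduceEq, if_true, if_false] at he
  obtain ⟨ha, hb, hp, hp', hq⟩ := he
  simp only [formWedge, wedge_apply, LinearMap.add_apply] at h
  have hC (x : V) : C x = a x • C (e 0) + p' x • C (e 3) + p x • D (e 3) := by
    have := h (e 0) (e 3) x
    simp only [ha, hp'] at this
    linear_combination (norm := module) this
  have hD (x : V) : D x = b x • D (e 1) + q x • D (e 4) + p x • C (e 4) := by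
    have := h (e 1) (e 4) x
    simp only [hb, hq] at this
    linear_combination (norm := module) this
  have hD' (x : V) : D x = b x • C (e 0) + a x • D (e 0) + p' x • C (e 2) + p x • D (e 2) := by
    have := h (e 0) (e 2) x
    simp only [ha, hp] at this
    linear_combination (norm := module) this
  have hC' (x : V) : C x = b x • C (e 1) + a x • D (e 1) + p x • C (e 2) + q x • D (e 2) := by
    have := h (e 1) (e 2) x
    simp only [hb, hp] at this
    linear_combination (norm := module) this
  have hC₃ : C (e 3) = 0 := by simpa [hp'] using hC' (e 3)
  have hD₃ : D (e 3) = 0 := by simpa [hp'] using hD (e 3)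
  have hC₄ : C (e 4) = 0 := by simpa [hq] using hC (e 4)
  have hD₄ : D (e 4) = 0 := by simpa [hq] using hD' (e 4)
  have hCD : C (e 0) = D (e 1) := by simpa [ha] using hC' (e 0)
  refine ⟨C (e 0), LinearMap.ext fun x => ?_, LinearMap.ext fun x => ?_⟩
  · simpa [hC₃, hD₃] using hC x
  · simpa [hC₄, hD₄, ← hCD] using hD x

theorem exists_dual_comp_ne_zero {C : V →ₗ[K] W} (hC : C ≠ 0) : ∃ φ : Dual K W, φ ∘ₗ C ≠ 0 := by
  by_contra! h
  exact hC (LinearMap.ext fun x => (forall_dual_apply_eq_zero_iff K _).1 fun φ =>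
    LinearMap.congr_fun (h φ) x)

theorem exists_dual_comp_eq_of_dependent {C D : V →ₗ[K] W} (hCD : LinearIndependent K ![C, D])
    (hdep : ∀ φ : Dual K W, ¬LinearIndependent K ![φ ∘ₗ C, φ ∘ₗ D]) :
    ∃ e : Dual K V, e ≠ 0 ∧ ∃ φ ψ : Dual K W,
      φ ∘ₗ C = e ∧ φ ∘ₗ D = 0 ∧ ψ ∘ₗ C = 0 ∧ ψ ∘ₗ D = e := by
  have hC : C ≠ 0 := hCD.ne_zero 0
  obtain ⟨φ₁, hφ₁⟩ := exists_dual_comp_ne_zero hC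
  obtain ⟨k, hk⟩ : ∃ k : K, k • φ₁ ∘ₗ C = φ₁ ∘ₗ D := by
    by_contra! hk
    exact hdep φ₁ ((LinearIndependent.pair_iff' hφ₁).2 hk)
  have hDk : D - k • C ≠ 0 := sub_ne_zero.2
    ((LinearIndependent.pair_iff' hC).1 hCD k).symm
  obtain ⟨ψ₁, hψ₁⟩ := exists_dual_comp_ne_zero hDk
  set e := ψ₁ ∘ₗ (D - k • C) with he
  have exists_eq_smul : ∀ χ : Dual K W, χ ∘ₗ (D - k • C) = e → ∃ m : K, m • e = χ ∘ₗ C := by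
    intro χ hχ
    by_contra! hm
    refine hdep χ (LinearIndependent.pair_iff.2 fun s t hst => ?_)
    have he_indep := (LinearIndependent.pair_iff' hψ₁).2 hm
    have := LinearIndependent.pair_iff.1 he_indep t (s + t * k) <| by
      rw [← hst, ← hχ, LinearMap.comp_sub, LinearMap.comp_smul]
      module
    simpa [this.1] using this.symm
  obtain ⟨m, hm⟩ := exists_eq_smul ψ₁ rfl
  obtain ⟨n, hn⟩ := exists_eq_smul (ψ₁ + φ₁) <| by
    rw [LinearMap.add_comp, ← he, LinearMap.comp_sub, LinearMap.comp_smul, hk, sub_self, add_zero]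
  have hφC : φ₁ ∘ₗ C = (n - m) • e := by
    rw [LinearMap.add_comp] at hn
    linear_combination (norm := module) hm - hn
  have hnm : n - m ≠ 0 := fun h0 => hφ₁ (by rw [hφC, h0, zero_smul])
  have hψD : ψ₁ ∘ₗ D = e + (k * m) • e := by
    rw [mul_smul, hm, he, LinearMap.comp_sub, LinearMap.comp_smul, sub_add_cancel]
  have hφD : φ₁ ∘ₗ D = (k * (n - m)) • e := by rw [← hk, hφC, smul_smul]
  obtain ⟨ψ, hψ⟩ : ∃ ψ, ψ = ψ₁ - (m * (n - m)⁻¹) • φ₁ := ⟨_, rfl⟩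
  refine ⟨e, hψ₁, (n - m)⁻¹ • φ₁ - k • ψ, ψ, ?_, ?_, ?_, ?_⟩ <;>
  simp only [hψ, LinearMap.sub_comp, LinearMap.smul_comp, hφC, hφD, ← hm, hψD] <;>
  match_scalars <;> field_simp <;> ring

theorem eq_zero_of_forall_dual_comp_ne {f g : Dual K V} {φ : Dual K W}
    {v w : W} (hf : φ ∘ₗ (f.smulRight v + g.smulRight w) = f)
    (hg : ∀ ψ : Dual K W, ψ ∘ₗ (f.smulRight v + g.smulRight w) ≠ g) : w = 0 := by
  refine (forall_dual_apply_eq_zero_iff K _).1 fun ψ => ?_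
  by_contra hψ
  refine hg ((ψ w)⁻¹ • (ψ - ψ v • φ)) (LinearMap.ext fun x => ?_)
  have hfx : φ ((f.smulRight v + g.smulRight w) x) = f x := LinearMap.congr_fun hf x
  rw [LinearMap.comp_apply, LinearMap.smul_apply, LinearMap.sub_apply, LinearMap.smul_apply, hfx]
  simp only [LinearMap.add_apply, LinearMap.smulRight_apply, map_add, map_smul, smul_eq_mul]
  field_simp
  ring

end LinearAlgebra

section LowerCentralSeries

variable {R L : Type*} [CommRing R] [LieRing L] [LieAlgebra R L]

theorem lie_mem_lowerCentralSeries_one (x y : L) :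
    ⁅x, y⁆ ∈ LieModule.lowerCentralSeries R L L 1 :=
  LieSubmodule.lie_mem_lie (LieSubmodule.mem_top x) (LieSubmodule.mem_top y)

theorem apply_eq_zero_of_mem_lowerCentralSeries_succ {V : Type*} [AddCommGroup V] [Module R V]
    {k : ℕ} {θ : L →ₗ[R] V}
    (h : ∀ x : L, ∀ y ∈ LieModule.lowerCentralSeries R L L k, θ ⁅x, y⁆ = 0) {u : L}
    (hu : u ∈ LieModule.lowerCentralSeries R L L (k + 1)) : θ u = 0 := by
  rw [LieModule.lowerCentralSeries_succ, ← LieSubmodule.mem_toSubmodule,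
    LieSubmodule.lieIdeal_oper_eq_linear_span'] at hu
  refine (Submodule.span_le (p := LinearMap.ker θ)).2 ?_ hu
  rintro _ ⟨x, -, y, hy, rfl⟩
  exact h x y hy

theorem apply_eq_zero_of_mem_lowerCentralSeries_one {V : Type*} [AddCommGroup V] [Module R V]
    {θ : L →ₗ[R] V} (h : ∀ x y : L, θ ⁅x, y⁆ = 0) {u : L}
    (hu : u ∈ LieModule.lowerCentralSeries R L L 1) : θ u = 0 :=
  apply_eq_zero_of_mem_lowerCentralSeries_succ (k := 0) (fun x y _ => h x y) hu

theorem lie_eq_zero_of_lowerCentralSeries_two_eq_bot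
    (hL : LieModule.lowerCentralSeries R L L 2 = ⊥) {u : L}
    (hu : u ∈ LieModule.lowerCentralSeries R L L 1) (x : L) : ⁅x, u⁆ = 0 := by
  rw [← LieSubmodule.mem_bot (R := R) (L := L), ← hL]
  exact LieSubmodule.lie_mem_lie (LieSubmodule.mem_top x) hu

theorem lowerCentralSeries_succ_lt {k m : ℕ} (hm : LieModule.lowerCentralSeries R L L m = ⊥)
    (hk : LieModule.lowerCentralSeries R L L k ≠ ⊥) :
    LieModule.lowerCentralSeries R L L (k + 1) < LieModule.lowerCentralSeries R L L k := by
  refine (LieModule.antitone_lowerCentralSeries R L L k.le_succ).lt_of_ne fun heq => hk ?_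
  have stable (j : ℕ) : LieModule.lowerCentralSeries R L L (k + j) =
      LieModule.lowerCentralSeries R L L k := by
    induction j with
    | zero => rfl
    | succ j ih =>
      rw [← add_assoc, LieModule.lowerCentralSeries_succ, ih, ← LieModule.lowerCentralSeries_succ,
        heq]
  rw [← stable m, eq_bot_iff, ← hm]
  exact LieModule.antitone_lowerCentralSeries R L L (Nat.le_add_left m k)

theorem lowerCentralSeries_two_eq_bot_of_lie_lie_lie (h : ∀ x y z : L, ⁅x, ⁅y, z⁆⁆ = 0) :
    LieModule.lowerCentralSeries R L L 2 = ⊥ :=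
  (LieSubmodule.eq_bot_iff _).2 fun _ => apply_eq_zero_of_mem_lowerCentralSeries_succ
    (θ := LinearMap.id) fun x _ => apply_eq_zero_of_mem_lowerCentralSeries_one
      (θ := (LieModule.toEnd R L L x : L →ₗ[R] L)) (h x)

theorem lowerCentralSeries_three_eq_bot_of_lie_lie_lie_lie
    (h : ∀ w x y z : L, ⁅w, ⁅x, ⁅y, z⁆⁆⁆ = 0) : LieModule.lowerCentralSeries R L L 3 = ⊥ :=
  (LieSubmodule.eq_bot_iff _).2 fun _ => apply_eq_zero_of_mem_lowerCentralSeries_succ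
    (θ := LinearMap.id) fun w _ => apply_eq_zero_of_mem_lowerCentralSeries_succ
      (θ := (LieModule.toEnd R L L w : L →ₗ[R] L)) fun x _ =>
        apply_eq_zero_of_mem_lowerCentralSeries_one
          (θ := (LieModule.toEnd R L L w : L →ₗ[R] L) ∘ₗ LieModule.toEnd R L L x) (h w x)

variable {L' : Type*} [LieRing L'] [LieAlgebra R L'] {m : ℕ}

theorem inl_mem_lowerCentralSeries {x : L} (hx : x ∈ LieModule.lowerCentralSeries R L L m) :
    (x, 0) ∈ LieModule.lowerCentralSeries R (L × L') (L × L') m :=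
  LieIdeal.map_lowerCentralSeries_le m (LieIdeal.mem_map (f := LieHom.inl R L L') hx)

theorem inr_mem_lowerCentralSeries {x : L'} (hx : x ∈ LieModule.lowerCentralSeries R L' L' m) :
    (0, x) ∈ LieModule.lowerCentralSeries R (L × L') (L × L') m :=
  LieIdeal.map_lowerCentralSeries_le m (LieIdeal.mem_map (f := LieHom.inr R L L') hx)

end LowerCentralSeries

section DerivedAlgebra

variable {L : Type*} [LieRing L] [LieAlgebra ℝ L]

theorem lowerCentralSeries_one_ne_bot (hd : finrank ℝ (LieModule.lowerCentralSeries ℝ L L 1) = 2) :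
    LieModule.lowerCentralSeries ℝ L L 1 ≠ ⊥ := fun h => by
  rw [h] at hd
  exact two_ne_zero (hd.symm.trans (finrank_bot ℝ L))

/-- The alternating form `(x, y) ↦ θ ⁅x, y⁆`; up to sign it is the coboundary of the linear form
`θ`. -/
def bracketForm (θ : Dual ℝ L) : LinearMap.BilinForm ℝ L :=
  (LieModule.toEnd ℝ L L : L →ₗ[ℝ] L →ₗ[ℝ] L).compr₂ θ

@[simp]
theorem bracketForm_apply (θ : Dual ℝ L) (x y : L) : bracketForm θ x y = θ ⁅x, y⁆ := rfl

theorem isAlt_bracketForm (θ : Dual ℝ L) : (bracketForm θ).IsAlt := fun x => by simp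

theorem bracketForm_add (θ θ' : Dual ℝ L) :
    bracketForm (θ + θ') = bracketForm θ + bracketForm θ' := rfl

theorem bracketForm_smul (c : ℝ) (θ : Dual ℝ L) : bracketForm (c • θ) = c • bracketForm θ := rfl

theorem bracketForm_apply_eq_zero (hL : LieModule.lowerCentralSeries ℝ L L 2 = ⊥) (θ : Dual ℝ L)
    {u : L} (hu : u ∈ LieModule.lowerCentralSeries ℝ L L 1) : bracketForm θ u = 0 :=
  LinearMap.ext fun x => by
    rw [bracketForm_apply, ← lie_skew, lie_eq_zero_of_lowerCentralSeries_two_eq_bot hL hu, neg_zero,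
      map_zero, LinearMap.zero_apply]

/-- The linear forms `η` and `ζ` restrict to linear coordinates of a two-dimensional derived
algebra, so that `bracketForm η` and `bracketForm ζ` are the structure constants of `L`. -/
structure IsFrame (η ζ : Dual ℝ L) : Prop where
  exists_eq : ∀ s t : ℝ, ∃ u ∈ LieModule.lowerCentralSeries ℝ L L 1, η u = s ∧ ζ u = t
  eq_zero : ∀ u ∈ LieModule.lowerCentralSeries ℝ L L 1, η u = 0 → ζ u = 0 → u = 0

namespace IsFrame

variable {η ζ : Dual ℝ L}

theorem change (h : IsFrame η ζ) {r s t u : ℝ} (hd : r * u - s * t ≠ 0) :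
    IsFrame (r • η + s • ζ) (t • η + u • ζ) := by
  constructor
  · intro c d
    obtain ⟨w, hw, hη, hζ⟩ :=
      h.exists_eq ((u * c - s * d) / (r * u - s * t)) ((r * d - t * c) / (r * u - s * t))
    refine ⟨w, hw, ?_, ?_⟩ <;>
    · simp only [LinearMap.add_apply, LinearMap.smul_apply, smul_eq_mul, hη, hζ, mul_div_assoc',
        ← add_div, div_eq_iff hd]
      ring
  · intro w hw h₁ h₂
    simp only [LinearMap.add_apply, LinearMap.smul_apply, smul_eq_mul] at h₁ h₂
    refine h.eq_zero w hw (mul_left_cancel₀ hd ?_) (mul_left_cancel₀ hd ?_)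
    · linear_combination u * h₁ - s * h₂
    · linear_combination r * h₂ - t * h₁

theorem swap (h : IsFrame η ζ) : IsFrame ζ η := by
  simpa using h.change (r := 0) (s := 1) (t := 1) (u := 0) (by norm_num)

theorem eq_zero_of_smul_bracketForm_add_eq_zero (h : IsFrame η ζ) {c d : ℝ}
    (hcd : c • bracketForm η + d • bracketForm ζ = 0) : c = 0 ∧ d = 0 := by
  have vanish {u : L} (hu : u ∈ LieModule.lowerCentralSeries ℝ L L 1) : (c • η + d • ζ) u = 0 :=
    apply_eq_zero_of_mem_lowerCentralSeries_one
      (fun x y => by simpa using LinearMap.congr_fun₂ hcd x y) hu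
  obtain ⟨u, hu, h₁, h₂⟩ := h.exists_eq 1 0
  obtain ⟨v, hv, h₃, h₄⟩ := h.exists_eq 0 1
  exact ⟨by simpa [h₁, h₂] using vanish hu, by simpa [h₃, h₄] using vanish hv⟩

theorem bracketForm_left_ne_zero (h : IsFrame η ζ) : bracketForm η ≠ 0 := fun h₀ =>
  one_ne_zero (h.eq_zero_of_smul_bracketForm_add_eq_zero (c := 1) (d := 0) (by simp [h₀])).1

theorem bracketForm_right_ne_zero (h : IsFrame η ζ) : bracketForm ζ ≠ 0 :=
  h.swap.bracketForm_left_ne_zero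

theorem exists_apply_eq (h : IsFrame η ζ) {ι : Type*} [Finite ι] {F : ι → Dual ℝ L}
    (hF : LinearIndependent ℝ F)
    (hF₀ : ∀ i, ∀ u ∈ LieModule.lowerCentralSeries ℝ L L 1, F i u = 0) (v : ι → ℝ) (s t : ℝ) :
    ∃ x, (∀ i, F i x = v i) ∧ η x = s ∧ ζ x = t := by
  obtain ⟨x₀, hx₀⟩ := exists_forall_apply_eq hF v
  obtain ⟨u, hu, hη, hζ⟩ := h.exists_eq (s - η x₀) (t - ζ x₀)
  exact ⟨x₀ + u, fun i => by rw [map_add, hx₀, hF₀ i u hu, add_zero],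
    by rw [map_add, hη, add_sub_cancel], by rw [map_add, hζ, add_sub_cancel]⟩

theorem lie_eq_zero (h : IsFrame η ζ) {x y : L} (hη : η ⁅x, y⁆ = 0) (hζ : ζ ⁅x, y⁆ = 0) :
    ⁅x, y⁆ = 0 :=
  h.eq_zero _ (lie_mem_lowerCentralSeries_one x y) hη hζ

end IsFrame

/-- `Y, Z` is the basis of the derived algebra dual to the frame `η, ζ`. -/
structure IsDualFrame (Y Z : L) (η ζ : Dual ℝ L) : Prop where
  left_mem : Y ∈ LieModule.lowerCentralSeries ℝ L L 1
  right_mem : Z ∈ LieModule.lowerCentralSeries ℝ L L 1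
  left_apply_left : η Y = 1
  left_apply_right : η Z = 0
  right_apply_left : ζ Y = 0
  right_apply_right : ζ Z = 1
  eq_smul_add_smul : ∀ u ∈ LieModule.lowerCentralSeries ℝ L L 1, u = η u • Y + ζ u • Z

theorem IsDualFrame.isFrame {Y Z : L} {η ζ : Dual ℝ L} (h : IsDualFrame Y Z η ζ) :
    IsFrame η ζ where
  exists_eq s t := ⟨s • Y + t • Z,
    add_mem (SMulMemClass.smul_mem s h.left_mem) (SMulMemClass.smul_mem t h.right_mem),
    by simp [h.left_apply_left, h.left_apply_right],
    by simp [h.right_apply_left, h.right_apply_right]⟩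
  eq_zero u hu hη hζ := by
    rw [h.eq_smul_add_smul u hu, hη, hζ, zero_smul, zero_smul, add_zero]

theorem exists_isDualFrame (hd : finrank ℝ (LieModule.lowerCentralSeries ℝ L L 1) = 2) {Y : L}
    (hY : Y ∈ LieModule.lowerCentralSeries ℝ L L 1) (hY₀ : Y ≠ 0) :
    ∃ (Z : L) (η ζ : Dual ℝ L), IsDualFrame Y Z η ζ := by
  let y : LieModule.lowerCentralSeries ℝ L L 1 := ⟨Y, hY⟩
  have hy : y ≠ 0 := fun h => hY₀ (congrArg Subtype.val h)
  obtain ⟨z, hyz⟩ := exists_linearIndependent_pair_of_one_lt_finrank (by rw [hd]; norm_num) hy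
  let b := basisOfLinearIndependentOfCardEqFinrank hyz (by simp [hd])
  have hb₀ : b 0 = y := by simp [b]
  have hb₁ : b 1 = z := by simp [b]
  obtain ⟨η, hη⟩ := LinearMap.exists_extend (b.coord 0)
  obtain ⟨ζ, hζ⟩ := LinearMap.exists_extend (b.coord 1)
  have hη' (w : LieModule.lowerCentralSeries ℝ L L 1) : η w = b.repr w 0 :=
    LinearMap.congr_fun hη w
  have hζ' (w : LieModule.lowerCentralSeries ℝ L L 1) : ζ w = b.repr w 1 :=
    LinearMap.congr_fun hζ w
  refine ⟨z, η, ζ, hY, z.2, ?_, ?_, ?_, ?_, fun u hu => ?_⟩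
  · rw [hη' y, ← hb₀]; simp
  · rw [hη' z, ← hb₁]; simp
  · rw [hζ' y, ← hb₀]; simp
  · rw [hζ' z, ← hb₁]; simp
  · have hu' := b.sum_repr ⟨u, hu⟩
    rw [Fin.sum_univ_two, hb₀, hb₁, ← hη', ← hζ'] at hu'
    exact congrArg Subtype.val hu'.symm

end DerivedAlgebra

section Classification

variable {L : Type*} [LieRing L] [LieAlgebra ℝ L] [FiniteDimensional ℝ L]

theorem nonempty_equiv_prod_of_injOn {G : Type*} [LieRing G] [LieAlgebra ℝ G] (φ : L →ₗ⁅ℝ⁆ G)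
    (hφ : Function.Surjective φ)
    (hi : ∀ u ∈ LieModule.lowerCentralSeries ℝ L L 1, φ u = 0 → u = 0) :
    ∃ k : ℕ, Nonempty (L ≃ₗ⁅ℝ⁆ G × Rab k) := by
  let N := LinearMap.ker (φ : L →ₗ[ℝ] G)
  have hdisj : Disjoint N (LieModule.lowerCentralSeries ℝ L L 1).toSubmodule :=
    Submodule.disjoint_def.2 fun u hN hu => hi u hu hN
  obtain ⟨D, hD, hND⟩ := hdisj.symm.exists_isCompl
  let e : N ≃ₗ[ℝ] (Fin (finrank ℝ N) → ℝ) := LinearEquiv.ofFinrankEq _ _ (by simp)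
  let P : L →ₗ[ℝ] Rab (finrank ℝ N) := e.toLinearMap ∘ₗ N.projectionOnto D hND.symm
  have P_lie (x y : L) : P ⁅x, y⁆ = 0 := e.map_eq_zero_iff.2 <|
    (Submodule.projectionOnto_apply_eq_zero_iff hND.symm).2
      (hD (lie_mem_lowerCentralSeries_one x y))
  have ker_P : LinearMap.ker P = D :=
    (e.ker_comp _).trans (Submodule.ker_projectionOnto hND.symm)
  have range_P : LinearMap.range P = ⊤ := LinearMap.range_eq_top.2 <|
    e.surjective.comp (LinearMap.range_eq_top.1 (Submodule.range_projectionOnto hND.symm))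
  let E := (φ : L →ₗ[ℝ] G).equivProdOfSurjectiveOfIsCompl P (LinearMap.range_eq_top.2 hφ)
    range_P (ker_P ▸ hND.symm)
  refine ⟨_, ⟨{ E with map_lie' := @fun x y => ?_ }⟩⟩
  exact Prod.ext (φ.map_lie x y) (P_lie x y)

variable (L) in
/-- `L` is one of the Lie algebras of the classification. -/
def IsListed : Prop :=
  ∃ k : ℕ,
    Nonempty (L ≃ₗ⁅ℝ⁆ (H1 × H1) × Rab k) ∨ Nonempty (L ≃ₗ⁅ℝ⁆ G41 × Rab k) ∨
    Nonempty (L ≃ₗ⁅ℝ⁆ G52 × Rab k) ∨ Nonempty (L ≃ₗ⁅ℝ⁆ G64 × Rab k) ∨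
    Nonempty (L ≃ₗ⁅ℝ⁆ G65 × Rab k)

namespace IsFrame

variable {η ζ : Dual ℝ L} {a p b q f g j : Dual ℝ L}

theorem isListed_of_g41 (h : IsFrame η ζ) (hη : bracketForm η = wedge f ζ)
    (hζ : bracketForm ζ = wedge f g)
    (hf : ∀ u ∈ LieModule.lowerCentralSeries ℝ L L 1, f u = 0)
    (hg : ∀ u ∈ LieModule.lowerCentralSeries ℝ L L 1, g u = 0) : IsListed L := by
  have hfg : LinearIndependent ℝ ![f, g] :=
    linearIndependent_of_wedge_ne_zero (hζ ▸ h.bracketForm_right_ne_zero)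
  have hη' (x y : L) : η ⁅x, y⁆ = wedge f ζ x y := LinearMap.congr_fun₂ hη x y
  have hζ' (x y : L) : ζ ⁅x, y⁆ = wedge f g x y := LinearMap.congr_fun₂ hζ x y
  let φ : L →ₗ⁅ℝ⁆ G41 :=
    { toLinearMap := (LinearMap.pi ![f, g, η, ζ] : L →ₗ[ℝ] (Fin 4 → ℝ))
      map_lie' := @fun x y => funext fun i => by
        have hl := lie_mem_lowerCentralSeries_one (R := ℝ) x y
        fin_cases i
        exacts [hf _ hl, hg _ hl, (hη' x y).trans (wedge_apply ..),
          (hζ' x y).trans (wedge_apply ..)] }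
  have hφ : Function.Surjective φ := fun v => by
    obtain ⟨x, hx, hx₂, hx₃⟩ :=
      h.exists_apply_eq hfg (by simpa [Fin.forall_fin_two] using ⟨hf, hg⟩) ![v 0, v 1] (v 2) (v 3)
    refine ⟨x, funext fun i => ?_⟩
    fin_cases i
    exacts [hx 0, hx 1, hx₂, hx₃]
  obtain ⟨k, hk⟩ := nonempty_equiv_prod_of_injOn φ hφ fun u hu hu₀ =>
    h.eq_zero u hu (congrFun hu₀ 2) (congrFun hu₀ 3)
  exact ⟨k, Or.inr (Or.inl hk)⟩

omit [FiniteDimensional ℝ L] in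
theorem linearIndependent_of_eq_wedge (h : IsFrame η ζ) (hη : bracketForm η = wedge f g)
    (hζ : bracketForm ζ = wedge f j) : LinearIndependent ℝ ![f, g, j] := by
  refine Fintype.linearIndependent_iff.2 fun c hc => ?_
  have hc' (x : L) : c 0 * f x + c 1 * g x + c 2 * j x = 0 := by
    simpa [Fin.sum_univ_three] using LinearMap.congr_fun hc x
  obtain ⟨h₁, h₂⟩ := h.eq_zero_of_smul_bracketForm_add_eq_zero (c := c 1) (d := c 2) <| by
    refine LinearMap.ext₂ fun x y => ?_
    simp only [hη, hζ, LinearMap.add_apply, LinearMap.smul_apply, wedge_apply, smul_eq_mul,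
      LinearMap.zero_apply]
    linear_combination f x * hc' y - f y * hc' x
  have hf : f ≠ 0 := by
    rintro rfl
    exact h.bracketForm_left_ne_zero (hη.trans (LinearMap.ext₂ fun x y => by simp [wedge_apply]))
  have h₀ : c 0 = 0 := (smul_eq_zero.1 (LinearMap.ext fun x => by
    simpa [h₁, h₂] using hc' x : c 0 • f = 0)).resolve_right hf
  intro i
  fin_cases i
  exacts [h₀, h₁, h₂]

theorem isListed_of_g52 (h : IsFrame η ζ) (hL : LieModule.lowerCentralSeries ℝ L L 2 = ⊥)
    (hη : bracketForm η = wedge f g) (hζ : bracketForm ζ = wedge f j) : IsListed L := by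
  have hfgj := h.linearIndependent_of_eq_wedge hη hζ
  have hF (i : Fin 3) (u : L) (hu : u ∈ LieModule.lowerCentralSeries ℝ L L 1) :
      ![f, g, j] i u = 0 := by
    have hfg := eq_zero_of_wedge_apply_eq_zero
      (linearIndependent_of_wedge_ne_zero (hη ▸ h.bracketForm_left_ne_zero))
      (hη ▸ bracketForm_apply_eq_zero hL η hu)
    have hfj := eq_zero_of_wedge_apply_eq_zero
      (linearIndependent_of_wedge_ne_zero (hζ ▸ h.bracketForm_right_ne_zero))
      (hζ ▸ bracketForm_apply_eq_zero hL ζ hu)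
    fin_cases i
    exacts [hfg.1, hfg.2, hfj.2]
  have hη' (x y : L) : η ⁅x, y⁆ = wedge f g x y := LinearMap.congr_fun₂ hη x y
  have hζ' (x y : L) : ζ ⁅x, y⁆ = wedge f j x y := LinearMap.congr_fun₂ hζ x y
  let φ : L →ₗ⁅ℝ⁆ G52 :=
    { toLinearMap := (LinearMap.pi ![f, g, j, η, ζ] : L →ₗ[ℝ] (Fin 5 → ℝ))
      map_lie' := @fun x y => funext fun i => by
        have hl := lie_mem_lowerCentralSeries_one (R := ℝ) x y
        fin_cases i
        exacts [hF 0 _ hl, hF 1 _ hl, hF 2 _ hl, (hη' x y).trans (wedge_apply ..),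
          (hζ' x y).trans (wedge_apply ..)] }
  have hφ : Function.Surjective φ := fun v => by
    obtain ⟨x, hx, hx₃, hx₄⟩ := h.exists_apply_eq hfgj hF ![v 0, v 1, v 2] (v 3) (v 4)
    refine ⟨x, funext fun i => ?_⟩
    fin_cases i
    exacts [hx 0, hx 1, hx 2, hx₃, hx₄]
  obtain ⟨k, hk⟩ := nonempty_equiv_prod_of_injOn φ hφ fun u hu hu₀ =>
    h.eq_zero u hu (congrFun hu₀ 3) (congrFun hu₀ 4)
  exact ⟨k, Or.inr (Or.inr (Or.inl hk))⟩

theorem isListed_of_h1_h1 (h : IsFrame η ζ) (hL : LieModule.lowerCentralSeries ℝ L L 2 = ⊥)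
    (hη : bracketForm η = wedge a p) (hζ : bracketForm ζ = wedge b q)
    (hi : LinearIndependent ℝ ![a, p, b, q]) : IsListed L := by
  have hF (i : Fin 4) (u : L) (hu : u ∈ LieModule.lowerCentralSeries ℝ L L 1) :
      ![a, p, b, q] i u = 0 := by
    refine eq_zero_of_wedge_add_wedge_apply_eq_zero hi ?_ i
    rw [← hη, ← hζ, ← bracketForm_add, bracketForm_apply_eq_zero hL _ hu]
  have hη' (x y : L) : η ⁅x, y⁆ = wedge a p x y := LinearMap.congr_fun₂ hη x y
  have hζ' (x y : L) : ζ ⁅x, y⁆ = wedge b q x y := LinearMap.congr_fun₂ hζ x y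
  let φ : L →ₗ⁅ℝ⁆ H1 × H1 :=
    { toLinearMap := (LinearMap.pi ![a, p, η] : L →ₗ[ℝ] (Fin 3 → ℝ)).prod
        (LinearMap.pi ![b, q, ζ] : L →ₗ[ℝ] (Fin 3 → ℝ))
      map_lie' := @fun x y => by
        have hl := lie_mem_lowerCentralSeries_one (R := ℝ) x y
        refine Prod.ext (funext fun i => ?_) (funext fun i => ?_) <;> fin_cases i
        exacts [hF 0 _ hl, hF 1 _ hl, (hη' x y).trans (wedge_apply ..), hF 2 _ hl, hF 3 _ hl,
          (hζ' x y).trans (wedge_apply ..)] }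
  have hφ : Function.Surjective φ := fun ⟨v, w⟩ => by
    obtain ⟨x, hx, hx₂, hx₂'⟩ := h.exists_apply_eq hi hF ![v 0, v 1, w 0, w 1] (v 2) (w 2)
    refine ⟨x, Prod.ext (funext fun i => ?_) (funext fun i => ?_)⟩ <;> fin_cases i
    exacts [hx 0, hx 1, hx₂, hx 2, hx 3, hx₂']
  obtain ⟨k, hk⟩ := nonempty_equiv_prod_of_injOn φ hφ fun u hu hu₀ =>
    h.eq_zero u hu (congrFun (congrArg Prod.fst hu₀) 2) (congrFun (congrArg Prod.snd hu₀) 2)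
  exact ⟨k, Or.inl hk⟩

theorem isListed_of_g64 (h : IsFrame η ζ) (hL : LieModule.lowerCentralSeries ℝ L L 2 = ⊥)
    (hη : bracketForm η = wedge a p + wedge b q) (hζ : bracketForm ζ = wedge a b)
    (hi : LinearIndependent ℝ ![a, p, b, q]) : IsListed L := by
  have hF (i : Fin 4) (u : L) (hu : u ∈ LieModule.lowerCentralSeries ℝ L L 1) :
      ![a, p, b, q] i u = 0 :=
    eq_zero_of_wedge_add_wedge_apply_eq_zero hi (hη ▸ bracketForm_apply_eq_zero hL η hu) i
  have hη' (x y : L) : η ⁅x, y⁆ = wedge a p x y + wedge b q x y := LinearMap.congr_fun₂ hη x y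
  have hζ' (x y : L) : ζ ⁅x, y⁆ = wedge a b x y := LinearMap.congr_fun₂ hζ x y
  let φ : L →ₗ⁅ℝ⁆ G64 :=
    { toLinearMap := (LinearMap.pi ![a, p, b, q, η, ζ] : L →ₗ[ℝ] (Fin 6 → ℝ))
      map_lie' := @fun x y => funext fun i => by
        have hl := lie_mem_lowerCentralSeries_one (R := ℝ) x y
        fin_cases i
        exacts [hF 0 _ hl, hF 1 _ hl, hF 2 _ hl, hF 3 _ hl,
          (hη' x y).trans (congrArg₂ _ (wedge_apply ..) (wedge_apply ..)),
          (hζ' x y).trans (wedge_apply ..)] }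
  have hφ : Function.Surjective φ := fun v => by
    obtain ⟨x, hx, hx₄, hx₅⟩ := h.exists_apply_eq hi hF ![v 0, v 1, v 2, v 3] (v 4) (v 5)
    refine ⟨x, funext fun i => ?_⟩
    fin_cases i
    exacts [hx 0, hx 1, hx 2, hx 3, hx₄, hx₅]
  obtain ⟨k, hk⟩ := nonempty_equiv_prod_of_injOn φ hφ fun u hu hu₀ =>
    h.eq_zero u hu (congrFun hu₀ 4) (congrFun hu₀ 5)
  exact ⟨k, Or.inr (Or.inr (Or.inr (Or.inl hk)))⟩

theorem isListed_of_g65 (h : IsFrame η ζ) (hL : LieModule.lowerCentralSeries ℝ L L 2 = ⊥)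
    (hη : bracketForm η = wedge a p + wedge b q) (hζ : bracketForm ζ = wedge a q + wedge p b)
    (hi : LinearIndependent ℝ ![a, p, b, q]) : IsListed L := by
  have hF (i : Fin 4) (u : L) (hu : u ∈ LieModule.lowerCentralSeries ℝ L L 1) :
      ![a, p, b, q] i u = 0 :=
    eq_zero_of_wedge_add_wedge_apply_eq_zero hi (hη ▸ bracketForm_apply_eq_zero hL η hu) i
  have hη' (x y : L) : η ⁅x, y⁆ = (a x * p y - p x * a y) - (q x * b y - b x * q y) := by
    rw [← bracketForm_apply, hη, LinearMap.add_apply, LinearMap.add_apply, wedge_apply,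
      wedge_apply]
    ring
  have hζ' (x y : L) : ζ ⁅x, y⁆ = wedge a q x y + wedge p b x y := LinearMap.congr_fun₂ hζ x y
  let φ : L →ₗ⁅ℝ⁆ G65 :=
    { toLinearMap := (LinearMap.pi ![a, p, q, b, η, ζ] : L →ₗ[ℝ] (Fin 6 → ℝ))
      map_lie' := @fun x y => funext fun i => by
        have hl := lie_mem_lowerCentralSeries_one (R := ℝ) x y
        fin_cases i
        exacts [hF 0 _ hl, hF 1 _ hl, hF 3 _ hl, hF 2 _ hl, hη' x y,
          (hζ' x y).trans (congrArg₂ _ (wedge_apply ..) (wedge_apply ..))] }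
  have hφ : Function.Surjective φ := fun v => by
    obtain ⟨x, hx, hx₄, hx₅⟩ := h.exists_apply_eq hi hF ![v 0, v 1, v 3, v 2] (v 4) (v 5)
    refine ⟨x, funext fun i => ?_⟩
    fin_cases i
    exacts [hx 0, hx 1, hx 3, hx 2, hx₄, hx₅]
  obtain ⟨k, hk⟩ := nonempty_equiv_prod_of_injOn φ hφ fun u hu hu₀ =>
    h.eq_zero u hu (congrFun hu₀ 4) (congrFun hu₀ 5)
  exact ⟨k, Or.inr (Or.inr (Or.inr (Or.inr hk)))⟩

end IsFrame
end Classification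

section Pencil

variable {L : Type*} [LieRing L] [LieAlgebra ℝ L] [FiniteDimensional ℝ L]

namespace IsFrame

variable {η ζ : Dual ℝ L} {a p p' b q : Dual ℝ L}

theorem isListed_of_common_factor (h : IsFrame η ζ)
    (hL : LieModule.lowerCentralSeries ℝ L L 2 = ⊥) {f : Dual ℝ L} (hf : f ≠ 0)
    (hη : ∀ x y z, formWedge (bracketForm η) f x y z = 0)
    (hζ : ∀ x y z, formWedge (bracketForm ζ) f x y z = 0) : IsListed L := by
  obtain ⟨x₀, hx₀⟩ := LinearMap.surjective hf 1
  exact h.isListed_of_g52 hL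
    (eq_wedge_of_formWedge_eq_zero (isAlt_bracketForm η) hx₀ hη)
    (eq_wedge_of_formWedge_eq_zero (isAlt_bracketForm ζ) hx₀ hζ)

open scoped Matrix in
theorem isListed_of_eq_dotProduct_cross (h : IsFrame η ζ)
    (hL : LieModule.lowerCentralSeries ℝ L L 2 = ⊥) (E : L →ₗ[ℝ] Fin 3 → ℝ) (u w : Fin 3 → ℝ)
    (hη : ∀ x y, bracketForm η x y = u ⬝ᵥ (E x ⨯₃ E y))
    (hζ : ∀ x y, bracketForm ζ x y = w ⬝ᵥ (E x ⨯₃ E y)) : IsListed L := by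
  have huw : LinearIndependent ℝ ![u, w] := LinearIndependent.pair_iff.2 fun c d hcd =>
    h.eq_zero_of_smul_bracketForm_add_eq_zero <| LinearMap.ext₂ fun x y => by
      simp only [LinearMap.add_apply, LinearMap.smul_apply, hη, hζ, ← smul_dotProduct,
        ← add_dotProduct, hcd, zero_dotProduct, LinearMap.zero_apply]
  set r := u ⨯₃ w with hr
  have hr₀ : r ⬝ᵥ r ≠ 0 := by
    rwa [Ne, dotProduct_self_eq_zero, ← Ne, hr, crossProduct_ne_zero_iff_linearIndependent]
  -- Each of the planes `u`, `w` contains the line `r`, which is therefore a common factor.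
  let f : Dual ℝ L := dotProductBilin ℝ ℝ r ∘ₗ E
  have hfx (x : L) : f x = r ⬝ᵥ E x := rfl
  refine h.isListed_of_common_factor hL (f := f) (fun hf => ?_) (fun x y z => ?_) fun x y z => ?_
  · refine h.bracketForm_left_ne_zero (LinearMap.ext₂ fun x y => ?_)
    have hx : r ⬝ᵥ E x = 0 := LinearMap.congr_fun hf x
    have hy : r ⬝ᵥ E y = 0 := LinearMap.congr_fun hf y
    refine (mul_eq_zero.1 ?_).resolve_left hr₀
    rw [hη, dotProduct_mul_triple_product, hx, hy, dotProduct_comm r u, dot_self_cross, zero_mul,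
      zero_mul, zero_mul, add_zero, add_zero]
  all_goals
    simp only [formWedge, hη, hζ, hfx, hr, cross_apply, Matrix.vec3_dotProduct, Matrix.cons_val,
      smul_eq_mul]
    ring

theorem isListed_of_ker_le_center (h : IsFrame η ζ)
    (hL : LieModule.lowerCentralSeries ℝ L L 2 = ⊥) (E : L →ₗ[ℝ] Fin 3 → ℝ)
    (hE : ∀ x, E x = 0 → ∀ y : L, ⁅x, y⁆ = 0) : IsListed L := by
  obtain ⟨s, hs⟩ : ∃ s : (Fin 3 → ℝ) →ₗ[ℝ] L, ∀ x, E (s (E x)) = E x := by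
    obtain ⟨g, hg⟩ := E.rangeRestrict.exists_rightInverse_of_surjective E.range_rangeRestrict
    obtain ⟨s, hs⟩ := LinearMap.exists_extend g
    refine ⟨s, fun x => ?_⟩
    have hsx := LinearMap.congr_fun hs (E.rangeRestrict x)
    have hgx := congrArg Subtype.val (LinearMap.congr_fun hg (E.rangeRestrict x))
    rwa [LinearMap.comp_apply, ← hsx] at hgx
  have left (x y : L) : ⁅s (E x), y⁆ = ⁅x, y⁆ := sub_eq_zero.1 <| by
    rw [← sub_lie, hE _ (by rw [map_sub, hs, sub_self])]
  have right (x y : L) : ⁅x, s (E y)⁆ = ⁅x, y⁆ := by rw [← lie_skew, left, lie_skew]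
  have exists_eq (θ : Dual ℝ L) :
      ∃ u : Fin 3 → ℝ, ∀ x y, bracketForm θ x y = u ⬝ᵥ crossProduct (E x) (E y) := by
    obtain ⟨u, hu⟩ := exists_eq_dotProduct_cross (β := (bracketForm θ).compl₁₂ s s)
      fun v => isAlt_bracketForm θ (s v)
    refine ⟨u, fun x y => ?_⟩
    rw [← hu, LinearMap.compl₁₂_apply, bracketForm_apply, bracketForm_apply, left, right]
  obtain ⟨u, hu⟩ := exists_eq η
  obtain ⟨w, hw⟩ := exists_eq ζ
  exact h.isListed_of_eq_dotProduct_cross hL E u w hu hw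

theorem isListed_of_not_linearIndependent (h : IsFrame η ζ)
    (hL : LieModule.lowerCentralSeries ℝ L L 2 = ⊥) (hi : ¬LinearIndependent ℝ ![a, p, b, q])
    (hηζ : ∀ x, a x = 0 → p x = 0 → b x = 0 → q x = 0 →
      bracketForm η x = 0 ∧ bracketForm ζ x = 0) : IsListed L := by
  obtain ⟨k, hk⟩ := exists_succAbove_of_not_linearIndependent hi
  refine h.isListed_of_ker_le_center hL
    (LinearMap.pi fun i => ![a, p, b, q] (k.succAbove i)) fun x hx y => ?_
  have hx' : ∀ i, ![a, p, b, q] i x = 0 :=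
    (Fin.forall_iff_succAbove k).2 ⟨hk x (congrFun hx), congrFun hx⟩
  obtain ⟨hη, hζ⟩ := hηζ x (hx' 0) (hx' 1) (hx' 2) (hx' 3)
  exact h.lie_eq_zero (LinearMap.congr_fun hη y) (LinearMap.congr_fun hζ y)

theorem isListed_of_hyperbolic (h : IsFrame η ζ) (hL : LieModule.lowerCentralSeries ℝ L L 2 = ⊥)
    (hη : bracketForm η = wedge a p) (hζ : bracketForm ζ = wedge b q) : IsListed L := by
  by_cases hi : LinearIndependent ℝ ![a, p, b, q]
  · exact h.isListed_of_h1_h1 hL hη hζ hi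
  · refine h.isListed_of_not_linearIndependent hL hi fun x ha hp hb hq => ⟨?_, ?_⟩
    · rw [hη, wedge_apply_eq_zero ha hp]
    · rw [hζ, wedge_apply_eq_zero hb hq]

theorem isListed_of_parabolic (h : IsFrame η ζ) (hL : LieModule.lowerCentralSeries ℝ L L 2 = ⊥)
    (hη : bracketForm η = wedge a p + wedge b q) (hζ : bracketForm ζ = wedge a b) :
    IsListed L := by
  by_cases hi : LinearIndependent ℝ ![a, p, b, q]
  · exact h.isListed_of_g64 hL hη hζ hi
  · refine h.isListed_of_not_linearIndependent hL hi fun x ha hp hb hq => ⟨?_, ?_⟩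
    · rw [hη, LinearMap.add_apply, wedge_apply_eq_zero ha hp,
        wedge_apply_eq_zero hb hq, add_zero]
    · rw [hζ, wedge_apply_eq_zero ha hb]

theorem isListed_of_elliptic (h : IsFrame η ζ) (hL : LieModule.lowerCentralSeries ℝ L L 2 = ⊥)
    (hη : bracketForm η = wedge a p + wedge b q) (hζ : bracketForm ζ = wedge a q + wedge p b) :
    IsListed L := by
  by_cases hi : LinearIndependent ℝ ![a, p, b, q]
  · exact h.isListed_of_g65 hL hη hζ hi
  · refine h.isListed_of_not_linearIndependent hL hi fun x ha hp hb hq => ⟨?_, ?_⟩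
    · rw [hη, LinearMap.add_apply, wedge_apply_eq_zero ha hp,
        wedge_apply_eq_zero hb hq, add_zero]
    · rw [hζ, LinearMap.add_apply, wedge_apply_eq_zero ha hq,
        wedge_apply_eq_zero hp hb, add_zero]

theorem isListed_of_monic_relation (h : IsFrame η ζ)
    (hL : LieModule.lowerCentralSeries ℝ L L 2 = ⊥) (hη : bracketForm η = wedge a p' + wedge b p)
    (hζ : bracketForm ζ = wedge a p + wedge b q) {m n c d : ℝ}
    (hr : p' + m • p + n • q = c • a + d • b) : IsListed L := by
  obtain ⟨k, rfl⟩ : ∃ k, m = 2 * k := ⟨m / 2, by ring⟩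
  obtain rfl : p' = c • a + d • b - (2 * k) • p - n • q := by rw [← hr]; module
  -- The substitution `b', P` completes the square: modulo `a` and `b` it turns the quadratic form
  -- `s² - 2kst + nt²` dual to the relation into `s² + (n - k²) t²`.
  let b' := b - k • a
  let P := p + k • q - d • a
  rcases lt_trichotomy (n - k ^ 2) 0 with hn | hn | hn
  · obtain ⟨r, hr₀, rfl⟩ : ∃ r : ℝ, 0 < r ∧ n = k ^ 2 - r ^ 2 :=
      ⟨√(k ^ 2 - n), Real.sqrt_pos.2 (by linarith), by rw [Real.sq_sqrt (by linarith)]; ring⟩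
    refine (h.change (r := 1) (s := k + r) (t := 1) (u := k - r) fun h₀ => by
      linarith).isListed_of_hyperbolic hL (a := b' + r • a) (p := P + r • q) (b := b' - r • a)
        (q := P - r • q) ?_ ?_
    all_goals
      refine LinearMap.ext₂ fun x y => ?_
      simp only [bracketForm_add, bracketForm_smul, hη, hζ, b', P, LinearMap.add_apply,
        LinearMap.sub_apply, LinearMap.smul_apply, wedge_apply, smul_eq_mul]
      ring
  · obtain rfl : n = k ^ 2 := by linarith
    refine (h.change (r := 0) (s := 1) (t := 1) (u := k) (by norm_num)).isListed_of_parabolic hL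
      (a := b') (p := q) (b := P) (q := -a) ?_ ?_
    all_goals
      refine LinearMap.ext₂ fun x y => ?_
      simp only [bracketForm_add, bracketForm_smul, hη, hζ, b', P, LinearMap.add_apply,
        LinearMap.sub_apply, LinearMap.neg_apply, LinearMap.smul_apply, wedge_apply, smul_eq_mul]
      ring
  · obtain ⟨r, hr₀, rfl⟩ : ∃ r : ℝ, 0 < r ∧ n = k ^ 2 + r ^ 2 :=
      ⟨√(n - k ^ 2), Real.sqrt_pos.2 (by linarith), by rw [Real.sq_sqrt (by linarith)]; ring⟩
    refine (h.change (r := 1) (s := k) (t := 0) (u := r)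
      (by simpa using hr₀.ne')).isListed_of_elliptic hL
        (a := b') (p := P) (b := -(r • a)) (q := r • q) ?_ ?_
    all_goals
      refine LinearMap.ext₂ fun x y => ?_
      simp only [bracketForm_add, bracketForm_smul, hη, hζ, b', P, LinearMap.add_apply,
        LinearMap.sub_apply, LinearMap.neg_apply, LinearMap.smul_apply, wedge_apply, smul_eq_mul]
      ring

theorem isListed_of_relation (h : IsFrame η ζ)
    (hL : LieModule.lowerCentralSeries ℝ L L 2 = ⊥) (hη : bracketForm η = wedge a p' + wedge b p)
    (hζ : bracketForm ζ = wedge a p + wedge b q) {l m n c d : ℝ}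
    (hr : l • p' + m • p + n • q = c • a + d • b) (hlmn : l ≠ 0 ∨ m ≠ 0 ∨ n ≠ 0) :
    IsListed L := by
  have monic {l m n c d : ℝ} {u v w a b : Dual ℝ L} (hl : l ≠ 0)
      (hr : l • u + m • v + n • w = c • a + d • b) :
      u + (m / l) • v + (n / l) • w = (c / l) • a + (d / l) • b := by
    simpa only [smul_add, smul_smul, inv_mul_cancel₀ hl, one_smul, ← div_eq_inv_mul] using
      congrArg (l⁻¹ • ·) hr
  by_cases hl : l = 0
  · by_cases hn : n = 0
    · have hm : m ≠ 0 := by tauto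
      have hp : p = (c / m) • a + (d / m) • b := by
        simpa [hl, hn] using monic (u := p) (v := p') (w := q) (m := l) (n := n) hm
          (by rwa [add_comm (m • p)])
      refine h.isListed_of_hyperbolic hL (a := a) (p := p' - (c / m) • b) (b := b)
        (q := q - (d / m) • a) ?_ ?_
      all_goals
        refine LinearMap.ext₂ fun x y => ?_
        simp only [hη, hζ, hp, LinearMap.add_apply, LinearMap.sub_apply, LinearMap.smul_apply,
          wedge_apply, smul_eq_mul]
        ring
    · have hr' : n • q + m • p + l • p' = d • b + c • a := by linear_combination (norm := module) hr
      exact h.swap.isListed_of_monic_relation hL (by rw [hζ, add_comm]) (by rw [hη, add_comm])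
        (monic hn hr')
  · exact h.isListed_of_monic_relation hL hη hζ (monic hl hr)

end IsFrame
end Pencil

section FormPairs

variable {L A : Type*} [LieRing L] [LieAlgebra ℝ L] [FiniteDimensional ℝ L] [AddCommGroup A]
  [Module ℝ A] {η ζ : Dual ℝ L} {C D : L →ₗ[ℝ] A}

namespace IsFrame

theorem isListed_or_exists_eq_smulRight (h : IsFrame η ζ)
    (hL : LieModule.lowerCentralSeries ℝ L L 2 = ⊥)
    (hCD : ∀ x y z, formWedge (bracketForm η) C x y z + formWedge (bracketForm ζ) D x y z = 0)
    {φ : Dual ℝ A} (hφ : LinearIndependent ℝ ![φ ∘ₗ C, φ ∘ₗ D]) :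
    IsListed L ∨ ∃ (a b : Dual ℝ L) (s : A),
      LinearIndependent ℝ ![a, b] ∧ C = a.smulRight s ∧ D = b.smulRight s := by
  set a := φ ∘ₗ C
  set b := φ ∘ₗ D
  obtain ⟨p, p', q, hη, hζ⟩ := exists_eq_wedge_of_formWedge_add_eq_zero (isAlt_bracketForm η)
    (isAlt_bracketForm ζ) hφ fun x y z => by
      rw [dual_comp_formWedge, dual_comp_formWedge, ← map_add, hCD, map_zero]
  by_cases hi : LinearIndependent ℝ ![a, b, p, p', q]
  · rw [hη, hζ] at hCD
    exact .inr ⟨a, b, (exists_eq_smulRight_of_formWedge_add_eq_zero hi hCD).imp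
      fun s hs => ⟨hφ, hs⟩⟩
  · obtain ⟨r, hr, hr₀⟩ := Fintype.not_linearIndependent_iff.1 hi
    simp only [Fin.sum_univ_five, Matrix.cons_val] at hr
    refine .inl (h.isListed_of_relation hL hη hζ (l := r 3) (m := r 2) (n := r 4) (c := -r 0)
      (d := -r 1) (by linear_combination (norm := module) hr) ?_)
    by_contra! hlmn
    obtain ⟨h₃, h₂, h₄⟩ := hlmn
    obtain ⟨h₀, h₁⟩ := LinearIndependent.pair_iff.1 hφ (r 0) (r 1) (by simpa [h₂, h₃, h₄] using hr)
    obtain ⟨i, hi₀⟩ := hr₀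
    fin_cases i <;> exact hi₀ ‹_›

theorem isListed_of_forall_dual_not_linearIndependent (h : IsFrame η ζ)
    (hL : LieModule.lowerCentralSeries ℝ L L 2 = ⊥) (hi : LinearIndependent ℝ ![C, D])
    (hCD : ∀ x y z, formWedge (bracketForm η) C x y z + formWedge (bracketForm ζ) D x y z = 0)
    (hdep : ∀ φ : Dual ℝ A, ¬LinearIndependent ℝ ![φ ∘ₗ C, φ ∘ₗ D]) : IsListed L := by
  obtain ⟨e, he, φ, ψ, hφC, hφD, hψC, hψD⟩ := exists_dual_comp_eq_of_dependent hi hdep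
  have apply_dual (χ : Dual ℝ A) (x y z : L) : formWedge (bracketForm η) (χ ∘ₗ C) x y z +
      formWedge (bracketForm ζ) (χ ∘ₗ D) x y z = 0 := by
    rw [dual_comp_formWedge, dual_comp_formWedge, ← map_add, hCD, map_zero]
  refine h.isListed_of_common_factor hL he (fun x y z => ?_) fun x y z => ?_
  · simpa [hφC, hφD, formWedge] using apply_dual φ x y z
  · simpa [hψC, hψD, formWedge] using apply_dual ψ x y z

theorem isListed_of_formWedge_right_eq_zero (h : IsFrame η ζ)
    (hL : LieModule.lowerCentralSeries ℝ L L 2 = ⊥)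
    (hD : ∀ x y z, formWedge (bracketForm ζ) D x y z = 0) {g : Dual ℝ L}
    (hg : ∀ φ : Dual ℝ A, φ ∘ₗ D ≠ g) (hgζ : ∀ x y z, formWedge (bracketForm ζ) g x y z = 0)
    (hgη : ∀ x y z, D x = 0 → D y = 0 → D z = 0 → formWedge (bracketForm η) g x y z = 0) :
    IsListed L := by
  have hg₀ : g ≠ 0 := fun h₀ => hg 0 (by rw [h₀, LinearMap.zero_comp])
  by_cases hD₀ : D = 0
  · exact h.isListed_of_common_factor hL hg₀ (fun x y z => hgη x y z (by simp [hD₀])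
      (by simp [hD₀]) (by simp [hD₀])) hgζ
  obtain ⟨φ, hφ⟩ := exists_dual_comp_ne_zero hD₀
  set f := φ ∘ₗ D
  have hfg : LinearIndependent ℝ ![f, g] :=
    (LinearIndependent.pair_iff' hφ).2 fun c hc => hg (c • φ) (by rw [LinearMap.smul_comp, hc])
  obtain ⟨k, hk⟩ := exists_eq_smul_wedge (isAlt_bracketForm ζ) hfg
    (fun x y z => by rw [dual_comp_formWedge, hD, map_zero]) hgζ
  have hk₀ : k ≠ 0 := fun h₀ => h.bracketForm_right_ne_zero (by rw [hk, h₀, zero_smul])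
  obtain ⟨v, w, hvw⟩ := exists_eq_smulRight_add_smulRight_of_formWedge_wedge_eq_zero (D := D) hfg
    fun x y z => smul_right_injective A hk₀ <| by
      simpa [formWedge, hk, smul_smul] using hD x y z
  have hw : w = 0 := eq_zero_of_forall_dual_comp_ne (φ := φ) (hvw ▸ rfl) (hvw ▸ hg)
  have D_eq_zero (x : L) (hx : f x = 0) : D x = 0 := by simp [hvw, hw, hx]
  obtain ⟨x₂, hx₂⟩ := exists_forall_apply_eq hfg ![0, 1]
  have hgx₂ : g x₂ = 1 := hx₂ 1
  obtain ⟨p, q, hη⟩ := exists_eq_wedge_add_wedge (isAlt_bracketForm η) hfg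
    fun x y fx gx fy gy => by
      simpa [formWedge, gx, gy, hgx₂] using
        hgη x y x₂ (D_eq_zero x fx) (D_eq_zero y fy) (D_eq_zero x₂ (hx₂ 0))
  refine (h.change (r := 1) (s := 0) (t := 0) (u := k⁻¹) (by simpa using hk₀)).isListed_of_parabolic
    hL (a := f) (p := p) (b := g) (q := q) ?_ ?_
  · rw [one_smul, zero_smul, add_zero, hη]
  · rw [zero_smul, zero_add, bracketForm_smul, hk, inv_smul_smul₀ hk₀]

end IsFrame
end FormPairs

section Cocycle

variable {L : Type*} [LieRing L] [LieAlgebra ℝ L]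

theorem dThree_of_forall_lie_eq_zero (γ : L [⋀^Fin 3]→ₗ[ℝ] ℝ) {u : L} (hu : ∀ x : L, ⁅x, u⁆ = 0)
    (x y z : L) : dThree γ x y z u =
      -(contractTwo γ z u ⁅x, y⁆ + contractTwo γ x u ⁅y, z⁆ + contractTwo γ y u ⁅z, x⁆) := by
  simp only [dThree, ← contractTwo_apply, hu, map_zero]
  rw [← lie_skew x z, map_neg]
  ring

namespace IsDualFrame

variable {Y Z : L} {η ζ : Dual ℝ L}

theorem contractTwo_right_apply (h : IsDualFrame Y Z η ζ) (γ : L [⋀^Fin 3]→ₗ[ℝ] ℝ) {u : L}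
    (hu : u ∈ LieModule.lowerCentralSeries ℝ L L 1) (x : L) :
    contractTwo γ x Z u = -(η u * contractTwo γ Y Z x) := by
  conv_lhs => rw [h.eq_smul_add_smul u hu]
  rw [map_add, map_smul, map_smul, contractTwo_apply_right, contractTwo_left_comm]
  simp

theorem contractTwo_left_apply (h : IsDualFrame Y Z η ζ) (γ : L [⋀^Fin 3]→ₗ[ℝ] ℝ) {u : L}
    (hu : u ∈ LieModule.lowerCentralSeries ℝ L L 1) (x : L) :
    contractTwo γ x Y u = ζ u * contractTwo γ Y Z x := by
  conv_lhs => rw [h.eq_smul_add_smul u hu]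
  rw [map_add, map_smul, map_smul, contractTwo_apply_right, contractTwo_left_comm, contractTwo_swap]
  simp

theorem formWedge_left_contractTwo (h : IsDualFrame Y Z η ζ) (γ : L [⋀^Fin 3]→ₗ[ℝ] ℝ)
    (hZ : ∀ x : L, ⁅x, Z⁆ = 0) (x y z : L) :
    formWedge (bracketForm η) (contractTwo γ Y Z) x y z = dThree γ x y z Z := by
  simp only [dThree_of_forall_lie_eq_zero γ hZ, formWedge, bracketForm_apply, smul_eq_mul,
    h.contractTwo_right_apply γ (lie_mem_lowerCentralSeries_one _ _)]
  ring

theorem formWedge_right_contractTwo (h : IsDualFrame Y Z η ζ) (γ : L [⋀^Fin 3]→ₗ[ℝ] ℝ)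
    (hY : ∀ x : L, ⁅x, Y⁆ = 0) (x y z : L) :
    formWedge (bracketForm ζ) (contractTwo γ Y Z) x y z = -dThree γ x y z Y := by
  simp only [dThree_of_forall_lie_eq_zero γ hY, formWedge, bracketForm_apply, smul_eq_mul,
    h.contractTwo_left_apply γ (lie_mem_lowerCentralSeries_one _ _)]
  ring

end IsDualFrame

variable {A : Type*} [AddCommGroup A] [Module ℝ A] [LieRingModule L A] [LieModule ℝ L A]
  {B : LinearMap.BilinForm ℝ A}

namespace QuadCocycle

theorem cyclic (c : QuadCocycle L B)
    (hinv : ∀ x y : L, c.α x y ∈ LieModule.maxTrivSubmodule ℝ L A) (x y z : L) :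
    c.α ⁅x, y⁆ z + c.α ⁅y, z⁆ x + c.α ⁅z, x⁆ y = 0 := by
  have h : d₂₃ ℝ L A c.α x y z = 0 := by rw [c.d_α]; rfl
  rw [d₂₃_apply, (LieModule.mem_maxTrivSubmodule ℝ L A _).1 (hinv y z) x,
    (LieModule.mem_maxTrivSubmodule ℝ L A _).1 (hinv x z) y,
    (LieModule.mem_maxTrivSubmodule ℝ L A _).1 (hinv x y) z, ← lie_skew x z, map_neg,
    LinearMap.neg_apply] at h
  rw [← neg_eq_zero, ← h]
  abel

theorem α_apply_eq_zero (c : QuadCocycle L B)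
    (hinv : ∀ x y : L, c.α x y ∈ LieModule.maxTrivSubmodule ℝ L A) {u v : L}
    (hv : ∀ x : L, ⁅x, v⁆ = 0) (hu : u ∈ LieModule.lowerCentralSeries ℝ L L 1) :
    c.α v u = 0 := by
  refine apply_eq_zero_of_mem_lowerCentralSeries_one (θ := c.α v) (fun x y => ?_) hu
  have h := c.cyclic hinv x y v
  rw [hv, ← lie_skew v x, hv, neg_zero, map_zero, LinearMap.zero_apply, LinearMap.zero_apply,
    add_zero, add_zero] at h
  rw [← twoCochain_skew, h, neg_zero]

theorem d_γ_apply (c : QuadCocycle L B) (hB : B.IsSymm) (w x y z : L) :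
    dThree c.γ w x y z =
      B (c.α w x) (c.α y z) - B (c.α w y) (c.α x z) + B (c.α w z) (c.α x y) := by
  rw [c.d_γ, wedge₂₂, hB.eq (c.α x y), hB.eq (c.α x z), hB.eq (c.α y z)]
  ring

end QuadCocycle

theorem IsDualFrame.formWedge_α_add_formWedge_α_eq_zero {Y Z : L} {η ζ : Dual ℝ L}
    (h : IsDualFrame Y Z η ζ) (c : QuadCocycle L B)
    (hinv : ∀ x y : L, c.α x y ∈ LieModule.maxTrivSubmodule ℝ L A) (x y z : L) :
    formWedge (bracketForm η) (c.α Y) x y z + formWedge (bracketForm ζ) (c.α Z) x y z = 0 := by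
  have hα (x y z : L) : c.α ⁅x, y⁆ z = η ⁅x, y⁆ • c.α Y z + ζ ⁅x, y⁆ • c.α Z z := by
    conv_lhs => rw [h.eq_smul_add_smul _ (lie_mem_lowerCentralSeries_one x y)]
    rw [map_add, map_smul, map_smul, LinearMap.add_apply, LinearMap.smul_apply,
      LinearMap.smul_apply]
  rw [← c.cyclic hinv x y z, hα, hα, hα]
  simp only [formWedge, bracketForm_apply]
  abel

theorem ConditionA.eq_zero {c : QuadCocycle L B} {k : ℕ} (h : ConditionA c (k + 1)) {Y : L}
    (hY : Y ∈ LieModule.lowerCentralSeries ℝ L L (k + 1)) (hYc : ∀ x : L, ⁅x, Y⁆ = 0)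
    (hα : c.α Y = 0) (A₀ : A)
    (hγ : ∀ x, ∀ y ∈ LieModule.lowerCentralSeries ℝ L L (k + 1),
      contractTwo c.γ x Y y = B A₀ (c.α y x)) : Y = 0 := by
  refine h Y ⟨hYc, hY⟩ ⟨A₀, 0, fun x => ⟨?_, fun y => ?_⟩⟩
  · rw [← twoCochain_skew, hα, LinearMap.zero_apply, neg_zero]
  · rw [← twoCochain_skew, map_neg, neg_neg, ← hγ x y y.2, LinearMap.zero_apply, add_zero,
      ← contractTwo_apply, contractTwo_swap, LinearMap.neg_apply, ← contractTwo_left_comm]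

theorem ConditionB.eq_zero_of_isotropic {c : QuadCocycle L B} {k : ℕ} (h : ConditionB c k)
    {s : A} (hs : B s s = 0)
    (hspan : ∀ x, ∀ y ∈ LieModule.lowerCentralSeries ℝ L L k, ∃ r : ℝ, c.α x y = r • s)
    (hmem : ∃ x, ∃ y ∈ LieModule.lowerCentralSeries ℝ L L k, ⁅x, y⁆ = 0 ∧ c.α x y = s) :
    s = 0 := by
  obtain ⟨x, y, hy, hxy, hα⟩ := hmem
  have hrange : LinearMap.range (cochainMap c.α k) ≤ Submodule.span ℝ {s} := by
    rintro _ ⟨t, rfl⟩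
    induction t using TensorProduct.induction_on with
    | zero => rw [map_zero]; exact zero_mem _
    | add t t' ht ht' => rw [map_add]; exact add_mem ht ht'
    | tmul a b =>
      obtain ⟨r, hr⟩ := hspan a b b.2
      exact Submodule.mem_span_singleton.2 ⟨r, hr.symm⟩
  have hsm : s ∈ (LinearMap.ker (bracketMap L k)).map (cochainMap c.α k) :=
    ⟨x ⊗ₜ ⟨y, hy⟩, hxy, hα⟩
  refine congrArg Subtype.val (h.1 ⟨s, hsm⟩ fun ⟨v, hv⟩ => ?_)
  obtain ⟨r, rfl⟩ := Submodule.mem_span_singleton.1 (hrange (LinearMap.map_le_range hv))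
  change B s (r • s) = 0
  rw [map_smul, hs, smul_zero]

theorem isListed_of_two_step_of_α_eq_zero [FiniteDimensional ℝ L]
    (hL : LieModule.lowerCentralSeries ℝ L L 2 = ⊥)
    (hd : finrank ℝ (LieModule.lowerCentralSeries ℝ L L 1) = 2)
    (hB : IsSemisimpleOrthogonalModule L A B) (c : QuadCocycle L B)
    (hinv : ∀ x y : L, c.α x y ∈ LieModule.maxTrivSubmodule ℝ L A) (hA : ConditionA c 1) {Y : L}
    (hY : Y ∈ LieModule.lowerCentralSeries ℝ L L 1) (hY₀ : Y ≠ 0) (hαY : c.α Y = 0) :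
    IsListed L := by
  have := hB.finiteDimensional
  obtain ⟨Z, η, ζ, h⟩ := exists_isDualFrame hd hY hY₀
  have hYc := lie_eq_zero_of_lowerCentralSeries_two_eq_bot hL hY
  have hZc := lie_eq_zero_of_lowerCentralSeries_two_eq_bot hL h.right_mem
  have α_apply_Y (x : L) : c.α x Y = 0 := by
    rw [← twoCochain_skew, hαY, LinearMap.zero_apply, neg_zero]
  refine h.isFrame.isListed_of_formWedge_right_eq_zero hL (D := c.α Z) (g := contractTwo c.γ Y Z)
    (fun x y z => ?_) (fun φ hφ => hY₀ ?_) (fun x y z => ?_) fun x y z hx hy hz => ?_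
  · simpa [hαY, formWedge] using h.formWedge_α_add_formWedge_α_eq_zero c hinv x y z
  · refine hA.eq_zero hY hYc hαY ((B.toDual hB.nondegenerate).symm φ) fun x y hy => ?_
    rw [h.contractTwo_left_apply c.γ hy, LinearMap.BilinForm.apply_toDual_symm_apply, ← hφ]
    conv_rhs => rw [h.eq_smul_add_smul y hy]
    simp [hαY]
  · rw [h.formWedge_right_contractTwo c.γ hYc, c.d_γ_apply hB.symm, α_apply_Y, α_apply_Y,
      α_apply_Y]
    simp
  · have α_apply_Z {x : L} (hx : c.α Z x = 0) : c.α x Z = 0 := by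
      rw [← twoCochain_skew, hx, neg_zero]
    rw [h.formWedge_left_contractTwo c.γ hZc, c.d_γ_apply hB.symm, α_apply_Z hx, α_apply_Z hy,
      α_apply_Z hz]
    simp

theorem isListed_of_two_step_of_dual_comp_α_linearIndependent [FiniteDimensional ℝ L]
    (hL : LieModule.lowerCentralSeries ℝ L L 2 = ⊥) (hBs : B.IsSymm) (c : QuadCocycle L B)
    (hinv : ∀ x y : L, c.α x y ∈ LieModule.maxTrivSubmodule ℝ L A) (hB : ConditionB c 1)
    {Y Z : L} {η ζ : Dual ℝ L} (h : IsDualFrame Y Z η ζ) {φ : Dual ℝ A}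
    (hφ : LinearIndependent ℝ ![φ ∘ₗ (c.α Y : L →ₗ[ℝ] A), φ ∘ₗ (c.α Z : L →ₗ[ℝ] A)]) :
    IsListed L := by
  have hYc := lie_eq_zero_of_lowerCentralSeries_two_eq_bot hL h.left_mem
  have hZc := lie_eq_zero_of_lowerCentralSeries_two_eq_bot hL h.right_mem
  refine (h.isFrame.isListed_or_exists_eq_smulRight hL
    (h.formWedge_α_add_formWedge_α_eq_zero c hinv) hφ).resolve_right ?_
  rintro ⟨a, b, s, hab, ha, hb⟩
  have α_apply_Y (x : L) : c.α x Y = -(a x • s) := by rw [← twoCochain_skew, ha]; rfl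
  have α_apply_Z (x : L) : c.α x Z = -(b x • s) := by rw [← twoCochain_skew, hb]; rfl
  obtain ⟨x₁, hx₁⟩ := exists_forall_apply_eq hab ![1, 0]
  obtain ⟨x₂, hx₂⟩ := exists_forall_apply_eq hab ![0, 1]
  have ha₁ : a x₁ = 1 := hx₁ 0
  have hb₁ : b x₁ = 0 := hx₁ 1
  have ha₂ : a x₂ = 0 := hx₂ 0
  have hb₂ : b x₂ = 1 := hx₂ 1
  have hss : B s s = 0 := by
    have hγ := h.formWedge_left_contractTwo c.γ hZc x₁ x₂ Y
    rw [c.d_γ_apply hBs, c.α_apply_eq_zero hinv hYc h.right_mem, α_apply_Y, α_apply_Y, α_apply_Z,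
      α_apply_Z] at hγ
    simpa [formWedge, hYc, ← lie_skew Y, contractTwo_apply_left, ha₁, ha₂, hb₁, hb₂] using hγ
  have hs : s = 0 := by
    refine hB.eq_zero_of_isotropic hss (fun x y hy => ⟨-(η y * a x + ζ y * b x), ?_⟩)
      ⟨-x₁, Y, h.left_mem, hYc _, by simp [α_apply_Y, ha₁]⟩
    conv_lhs => rw [h.eq_smul_add_smul y hy]
    rw [map_add, map_smul, map_smul, α_apply_Y, α_apply_Z]
    module
  refine hφ.ne_zero 0 ?_
  simp [ha, hs]

theorem isListed_of_two_step [FiniteDimensional ℝ L]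
    (hL : LieModule.lowerCentralSeries ℝ L L 2 = ⊥)
    (hd : finrank ℝ (LieModule.lowerCentralSeries ℝ L L 1) = 2)
    (hB : IsSemisimpleOrthogonalModule L A B) (c : QuadCocycle L B)
    (hinv : ∀ x y : L, c.α x y ∈ LieModule.maxTrivSubmodule ℝ L A) (hA₁ : ConditionA c 1)
    (hB₁ : ConditionB c 1) : IsListed L := by
  by_cases hα : ∃ Y ∈ LieModule.lowerCentralSeries ℝ L L 1, Y ≠ 0 ∧ c.α Y = 0
  · obtain ⟨Y, hY, hY₀, hαY⟩ := hα
    exact isListed_of_two_step_of_α_eq_zero hL hd hB c hinv hA₁ hY hY₀ hαY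
  push Not at hα
  obtain ⟨Y, hY, hY₀⟩ := Submodule.exists_mem_ne_zero_of_ne_bot
    ((LieSubmodule.toSubmodule_eq_bot _).not.2 (lowerCentralSeries_one_ne_bot hd))
  obtain ⟨Z, η, ζ, h⟩ := exists_isDualFrame hd hY hY₀
  by_cases hφ : ∃ φ : Dual ℝ A,
      LinearIndependent ℝ ![φ ∘ₗ (c.α Y : L →ₗ[ℝ] A), φ ∘ₗ (c.α Z : L →ₗ[ℝ] A)]
  · obtain ⟨φ, hφ⟩ := hφ
    exact isListed_of_two_step_of_dual_comp_α_linearIndependent hL hB.symm c hinv hB₁ h hφ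
  push Not at hφ
  refine h.isFrame.isListed_of_forall_dual_not_linearIndependent hL ?_
    (h.formWedge_α_add_formWedge_α_eq_zero c hinv) hφ
  refine LinearIndependent.pair_iff.2 fun r s hrs => ?_
  have hYZ : r • Y + s • Z = 0 := by
    by_contra h₀
    exact hα _ (add_mem (SMulMemClass.smul_mem r hY) (SMulMemClass.smul_mem s h.right_mem)) h₀
      (by rw [map_add, map_smul, map_smul, hrs])
  have hη := congrArg η hYZ
  have hζ := congrArg ζ hYZ
  simp only [map_add, map_smul, h.left_apply_left, h.left_apply_right, h.right_apply_left,
    h.right_apply_right, smul_eq_mul, map_zero, mul_one, mul_zero, add_zero, zero_add] at hη hζ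
  exact ⟨hη, hζ⟩

end Cocycle

section ThreeStep

variable {L : Type*} [LieRing L] [LieAlgebra ℝ L]

/-- A dual frame adapted to the lower central series of a three-step nilpotent Lie algebra: `Y`
spans its last non-zero term, and `f` records how `L` acts on the derived algebra. -/
structure IsThreeStepFrame (Y Z : L) (η ζ f : Dual ℝ L) : Prop extends IsDualFrame Y Z η ζ where
  left_mem_two : Y ∈ LieModule.lowerCentralSeries ℝ L L 2
  lie_left : ∀ x : L, ⁅x, Y⁆ = 0
  lie_right : ∀ x : L, ⁅x, Z⁆ = f x • Y

theorem exists_isThreeStepFrame (hd : finrank ℝ (LieModule.lowerCentralSeries ℝ L L 1) = 2)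
    (h₂ : LieModule.lowerCentralSeries ℝ L L 2 ≠ ⊥)
    (h₃ : LieModule.lowerCentralSeries ℝ L L 3 = ⊥) :
    ∃ (Y Z : L) (η ζ f : Dual ℝ L), IsThreeStepFrame Y Z η ζ f := by
  obtain ⟨Y, hY₂, hY₀⟩ := Submodule.exists_mem_ne_zero_of_ne_bot
    ((LieSubmodule.toSubmodule_eq_bot _).not.2 h₂)
  have lie_eq_zero {u : L} (hu : u ∈ LieModule.lowerCentralSeries ℝ L L 2) (x : L) :
      ⁅x, u⁆ = 0 := by
    rw [← LieSubmodule.mem_bot (R := ℝ) (L := L), ← h₃]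
    exact LieSubmodule.lie_mem_lie (LieSubmodule.mem_top x) hu
  obtain ⟨Z, η, ζ, h⟩ := exists_isDualFrame hd
    (LieModule.antitone_lowerCentralSeries ℝ L L one_le_two hY₂) hY₀
  refine ⟨Y, Z, η, ζ, -bracketForm η Z, h, hY₂, lie_eq_zero hY₂, fun x => ?_⟩
  have hxZ : ⁅x, Z⁆ = η ⁅x, Z⁆ • Y + ζ ⁅x, Z⁆ • Z :=
    h.eq_smul_add_smul _ (lie_mem_lowerCentralSeries_one x Z)
  have hζ : ζ ⁅x, Z⁆ = 0 := by
    have hxxZ : ζ ⁅x, ⁅x, Z⁆⁆ = 0 := by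
      rw [lie_eq_zero (LieSubmodule.lie_mem_lie (LieSubmodule.mem_top x) h.right_mem), map_zero]
    rw [hxZ, lie_add, lie_smul, lie_smul, lie_eq_zero hY₂, smul_zero, zero_add, map_smul,
      smul_eq_mul] at hxxZ
    exact mul_self_eq_zero.1 hxxZ
  rw [LinearMap.neg_apply, bracketForm_apply, ← map_neg, lie_skew]
  rwa [hζ, zero_smul, add_zero] at hxZ

namespace IsThreeStepFrame

variable {Y Z : L} {η ζ f : Dual ℝ L}

theorem ne_zero (h : IsThreeStepFrame Y Z η ζ f) : Y ≠ 0 := fun h₀ => by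
  simpa [h₀] using h.left_apply_left

theorem lie_eq_smul (h : IsThreeStepFrame Y Z η ζ f) (x : L) {u : L}
    (hu : u ∈ LieModule.lowerCentralSeries ℝ L L 1) : ⁅x, u⁆ = (ζ u * f x) • Y := by
  conv_lhs => rw [h.eq_smul_add_smul u hu]
  rw [lie_add, lie_smul, lie_smul, h.lie_left, h.lie_right, smul_zero, zero_add, smul_smul]

theorem apply_eq_zero (h : IsThreeStepFrame Y Z η ζ f) {u : L}
    (hu : u ∈ LieModule.lowerCentralSeries ℝ L L 1) : f u = 0 := by
  have hY : f Y • Y = 0 := by rw [← h.lie_right, ← lie_skew, h.lie_left, neg_zero]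
  have hZ : f Z • Y = 0 := by rw [← h.lie_right, lie_self]
  rw [h.eq_smul_add_smul u hu, map_add, map_smul, map_smul,
    (smul_eq_zero.1 hY).resolve_right h.ne_zero, (smul_eq_zero.1 hZ).resolve_right h.ne_zero,
    smul_zero, smul_zero, add_zero]

theorem eq_smul_of_mem_two (h : IsThreeStepFrame Y Z η ζ f) {u : L}
    (hu : u ∈ LieModule.lowerCentralSeries ℝ L L 2) : u = η u • Y := by
  have hζ : ζ u = 0 := apply_eq_zero_of_mem_lowerCentralSeries_succ (k := 1)
    (fun x y hy => by
      rw [h.lie_eq_smul x hy, map_smul, h.right_apply_left, smul_zero]) hu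
  simpa [hζ] using h.eq_smul_add_smul u (LieModule.antitone_lowerCentralSeries ℝ L L one_le_two hu)

theorem exists_apply_eq_one (h : IsThreeStepFrame Y Z η ζ f) : ∃ x, f x = 1 := by
  refine LinearMap.surjective (fun hf => h.ne_zero ?_) 1
  refine apply_eq_zero_of_mem_lowerCentralSeries_succ (k := 1) (θ := LinearMap.id)
    (fun x y hy => ?_) h.left_mem_two
  rw [LinearMap.id_apply, h.lie_eq_smul x hy, hf, LinearMap.zero_apply, mul_zero, zero_smul]

theorem formWedge_right_eq_zero (h : IsThreeStepFrame Y Z η ζ f) (x y z : L) :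
    formWedge (bracketForm ζ) f x y z = 0 := by
  refine (smul_eq_zero.1 ?_).resolve_right h.ne_zero
  rw [← lie_jacobi x y z, h.lie_eq_smul x (lie_mem_lowerCentralSeries_one y z),
    h.lie_eq_smul y (lie_mem_lowerCentralSeries_one z x),
    h.lie_eq_smul z (lie_mem_lowerCentralSeries_one x y)]
  simp only [formWedge, bracketForm_apply, smul_eq_mul]
  module

theorem isListed (h : IsThreeStepFrame Y Z η ζ f) [FiniteDimensional ℝ L]
    (hη : ∀ x y z, formWedge (bracketForm η) f x y z = 0) : IsListed L := by
  obtain ⟨x₁, hx₁⟩ := h.exists_apply_eq_one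
  have bracketForm_apply_x₁ (θ : Dual ℝ L) {u : L}
      (hu : u ∈ LieModule.lowerCentralSeries ℝ L L 1) : bracketForm θ x₁ u = ζ u * θ Y := by
    rw [bracketForm_apply, h.lie_eq_smul x₁ hu, hx₁, mul_one, map_smul, smul_eq_mul]
  have hζ' {u : L} (hu : u ∈ LieModule.lowerCentralSeries ℝ L L 1) : bracketForm η x₁ u = ζ u := by
    rw [bracketForm_apply_x₁ η hu, h.left_apply_left, mul_one]
  have frame : IsFrame η (bracketForm η x₁) := by
    refine ⟨fun s t => ?_, fun u hu h₁ h₂ => h.isFrame.eq_zero u hu h₁ ((hζ' hu).symm.trans h₂)⟩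
    obtain ⟨u, hu, h₁, h₂⟩ := h.isFrame.exists_eq s t
    exact ⟨u, hu, h₁, (hζ' hu).trans h₂⟩
  have hbr : bracketForm (bracketForm η x₁) = bracketForm ζ :=
    LinearMap.ext₂ fun x y => hζ' (lie_mem_lowerCentralSeries_one x y)
  refine frame.isListed_of_g41 (f := f) (g := bracketForm ζ x₁)
    (eq_wedge_of_formWedge_eq_zero (isAlt_bracketForm η) hx₁ hη)
    (hbr.trans <| eq_wedge_of_formWedge_eq_zero (isAlt_bracketForm ζ) hx₁
      h.formWedge_right_eq_zero)
    (fun u hu => h.apply_eq_zero hu) fun u hu => ?_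
  rw [bracketForm_apply_x₁ ζ hu, h.right_apply_left, mul_zero]

variable {A : Type*} [AddCommGroup A] [Module ℝ A] [LieRingModule L A] [LieModule ℝ L A]
  {B : LinearMap.BilinForm ℝ A} (c : QuadCocycle L B)

theorem exists_α_eq_smulRight (h : IsThreeStepFrame Y Z η ζ f)
    (hinv : ∀ x y : L, c.α x y ∈ LieModule.maxTrivSubmodule ℝ L A) :
    ∃ a : A, c.α Y = f.smulRight a := by
  obtain ⟨x₁, hx₁⟩ := h.exists_apply_eq_one
  refine ⟨c.α Y x₁, LinearMap.ext fun x => ?_⟩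
  have hx := c.cyclic hinv x₁ Z x
  have hα : c.α ⁅x, x₁⁆ Z = 0 := by
    rw [h.eq_smul_add_smul _ (lie_mem_lowerCentralSeries_one x x₁), map_add, map_smul, map_smul,
      LinearMap.add_apply, LinearMap.smul_apply, LinearMap.smul_apply, twoCochain_alt,
      c.α_apply_eq_zero hinv h.lie_left h.right_mem, smul_zero, smul_zero, add_zero]
  rw [hα, h.lie_right, hx₁, one_smul, ← lie_skew, h.lie_right, add_zero, map_neg, map_smul,
    LinearMap.neg_apply, LinearMap.smul_apply] at hx
  exact sub_eq_zero.1 ((sub_eq_add_neg _ _).trans hx)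

theorem apply_self_ne_zero (h : IsThreeStepFrame Y Z η ζ f) {a : A} (ha : c.α Y = f.smulRight a)
    (hA : ConditionA c 2) (hB : ConditionB c 2) : B a a ≠ 0 := fun haa => by
  obtain ⟨x₁, hx₁⟩ := h.exists_apply_eq_one
  have α_apply_Y (x : L) : c.α x Y = -(f x • a) := by rw [← twoCochain_skew, ha]; rfl
  have ha₀ : a = 0 := hB.eq_zero_of_isotropic haa
    (fun x y hy => ⟨-(η y * f x), by
      conv_lhs => rw [h.eq_smul_of_mem_two hy]
      rw [map_smul, α_apply_Y]
      module⟩)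
    ⟨-x₁, Y, h.left_mem_two, h.lie_left _, by simp [α_apply_Y, hx₁]⟩
  refine h.ne_zero (hA.eq_zero h.left_mem_two h.lie_left (by simp [ha, ha₀]) 0 fun x y hy => ?_)
  rw [h.eq_smul_of_mem_two hy, map_smul, contractTwo_apply_right, map_zero]
  simp

theorem exists_apply_α_eq_smul (h : IsThreeStepFrame Y Z η ζ f) (hB : B.IsSymm) {a : A}
    (ha : c.α Y = f.smulRight a) : ∃ k : ℝ, B a ∘ₗ (c.α Z : L →ₗ[ℝ] A) = k • f := by
  obtain ⟨x₁, hx₁⟩ := h.exists_apply_eq_one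
  refine ⟨B a (c.α Z x₁), LinearMap.ext fun x => ?_⟩
  have α_apply_Y (x : L) : c.α x Y = -(f x • a) := by rw [← twoCochain_skew, ha]; rfl
  have hζ (y : L) : ζ ⁅y, Z⁆ = 0 := by rw [h.lie_right, map_smul, h.right_apply_left, smul_zero]
  have hγ := h.formWedge_right_contractTwo c.γ h.lie_left x₁ x Z
  rw [c.d_γ_apply hB, α_apply_Y, α_apply_Y, α_apply_Y, h.apply_eq_zero h.right_mem,
    ← twoCochain_skew c.α Z x, ← twoCochain_skew c.α Z x₁] at hγ
  simp only [formWedge, bracketForm_apply, ← lie_skew Z x₁, contractTwo_apply_right, map_neg, hζ,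
    map_smul, hx₁, hB.eq _ a, LinearMap.neg_apply, LinearMap.smul_apply, smul_eq_mul] at hγ
  simp only [LinearMap.comp_apply, LinearMap.smul_apply, smul_eq_mul]
  linear_combination hγ

theorem formWedge_left_eq_zero (h : IsThreeStepFrame Y Z η ζ f)
    (hinv : ∀ x y : L, c.α x y ∈ LieModule.maxTrivSubmodule ℝ L A) (hB : B.IsSymm)
    (hA : ConditionA c 2) (hB₂ : ConditionB c 2) (x y z : L) :
    formWedge (bracketForm η) f x y z = 0 := by
  obtain ⟨a, ha⟩ := h.exists_α_eq_smulRight c hinv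
  obtain ⟨k, hk⟩ := h.exists_apply_α_eq_smul c hB ha
  have hYa : B a ∘ₗ (c.α Y : L →ₗ[ℝ] A) = B a a • f :=
    LinearMap.ext fun x => by simp [ha, mul_comm]
  have hα := congrArg (B a) (h.formWedge_α_add_formWedge_α_eq_zero c hinv x y z)
  rw [map_add, map_zero, ← dual_comp_formWedge, ← dual_comp_formWedge, hYa, hk] at hα
  have hζ := h.formWedge_right_eq_zero x y z
  refine (mul_eq_zero.1 ?_).resolve_left (h.apply_self_ne_zero c ha hA hB₂)
  simp only [formWedge, LinearMap.smul_apply, smul_eq_mul] at hα hζ ⊢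
  linear_combination hα - k * hζ

end IsThreeStepFrame

theorem isListed_of_three_step [FiniteDimensional ℝ L] {A : Type*} [AddCommGroup A] [Module ℝ A]
    [LieRingModule L A] [LieModule ℝ L A] {B : LinearMap.BilinForm ℝ A}
    (h₂ : LieModule.lowerCentralSeries ℝ L L 2 ≠ ⊥)
    (h₃ : LieModule.lowerCentralSeries ℝ L L 3 = ⊥)
    (hd : finrank ℝ (LieModule.lowerCentralSeries ℝ L L 1) = 2) (hB : B.IsSymm)
    (c : QuadCocycle L B) (hinv : ∀ x y : L, c.α x y ∈ LieModule.maxTrivSubmodule ℝ L A)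
    (hA₂ : ConditionA c 2) (hB₂ : ConditionB c 2) : IsListed L := by
  obtain ⟨Y, Z, η, ζ, f, h⟩ := exists_isThreeStepFrame hd h₂ h₃
  exact h.isListed (h.formWedge_left_eq_zero c hinv hB hA₂ hB₂)

end ThreeStep

section Admissible

variable {L : Type*} [LieRing L] [LieAlgebra ℝ L]

theorem lowerCentralSeries_three_eq_bot [FiniteDimensional ℝ L] {m : ℕ}
    (hm : LieModule.lowerCentralSeries ℝ L L m = ⊥)
    (hd : finrank ℝ (LieModule.lowerCentralSeries ℝ L L 1) = 2) :
    LieModule.lowerCentralSeries ℝ L L 3 = ⊥ := by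
  have finrank_succ_lt {k : ℕ} (hk : LieModule.lowerCentralSeries ℝ L L k ≠ ⊥) :
      finrank ℝ (LieModule.lowerCentralSeries ℝ L L (k + 1)).toSubmodule <
        finrank ℝ (LieModule.lowerCentralSeries ℝ L L k).toSubmodule :=
    Submodule.finrank_lt_finrank_of_lt (lowerCentralSeries_succ_lt hm hk)
  by_contra h₃
  have ne_bot {k : ℕ} (hk : k ≤ 3) : LieModule.lowerCentralSeries ℝ L L k ≠ ⊥ := fun h =>
    h₃ (eq_bot_iff.2 (h ▸ LieModule.antitone_lowerCentralSeries ℝ L L hk))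
  have h₁₂ := finrank_succ_lt (ne_bot (k := 1) (by decide))
  have h₂₃ := finrank_succ_lt (ne_bot (k := 2) (by decide))
  have h₃₄ := finrank_succ_lt h₃
  change finrank ℝ (LieModule.lowerCentralSeries ℝ L L 1).toSubmodule = 2 at hd
  simp only [Nat.reduceAdd] at h₁₂ h₂₃
  omega

theorem IsAdmissible.isListed [FiniteDimensional ℝ L] (h : IsAdmissible L)
    (hd : finrank ℝ (LieModule.lowerCentralSeries ℝ L L 1) = 2) : IsListed L := by
  obtain ⟨A, _, _, _, _, B, hB, φ, c, -, hinv, m, hm, hAB⟩ := h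
  have le_of_ne_bot {k : ℕ} (hk : LieModule.lowerCentralSeries ℝ L L k ≠ ⊥) : k ≤ m := by
    by_contra! hmk
    exact hk (eq_bot_iff.2 (hm ▸ LieModule.antitone_lowerCentralSeries ℝ L L hmk))
  by_cases h₂ : LieModule.lowerCentralSeries ℝ L L 2 = ⊥
  · obtain ⟨hA₁, hB₁⟩ := hAB 1 (le_of_ne_bot (lowerCentralSeries_one_ne_bot hd))
    exact isListed_of_two_step h₂ hd hB c hinv hA₁ hB₁
  · obtain ⟨hA₂, hB₂⟩ := hAB 2 (le_of_ne_bot h₂)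
    exact isListed_of_three_step h₂ (lowerCentralSeries_three_eq_bot hm hd) hd hB.symm c hinv
      hA₂ hB₂

end Admissible

section RotationModule

theorem complementedLattice_of_anisotropic {K L M : Type*} [Field K] [LieRing L] [AddCommGroup M]
    [Module K M] [FiniteDimensional K M] [LieRingModule L M] {B : LinearMap.BilinForm K M}
    (hB : B.IsRefl) (hskew : ∀ (x : L) (a b : M), B ⁅x, a⁆ b + B a ⁅x, b⁆ = 0)
    (hanis : ∀ a : M, B a a = 0 → a = 0) : ComplementedLattice (LieSubmodule K L M) := by
  refine ⟨fun N => ?_⟩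
  let N' : LieSubmodule K L M :=
    { B.orthogonal N.toSubmodule with
      lie_mem := fun {x b} hb a ha => by
        have hxa : B ⁅x, a⁆ b = 0 := hb _ (N.lie_mem ha)
        exact (zero_add (B a ⁅x, b⁆)).symm.trans (hxa ▸ hskew x a b) }
  have hN : (B.restrict N.toSubmodule).Nondegenerate :=
    ⟨fun a ha => Subtype.ext (hanis _ (ha a)), fun a ha => Subtype.ext (hanis _ (ha a))⟩
  exact ⟨N', LieSubmodule.isCompl_toSubmodule.1
    (LinearMap.BilinForm.isCompl_orthogonal_of_restrict_nondegenerate hB hN)⟩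

variable {L : Type*} [LieRing L] [LieAlgebra ℝ L] {ι κ : Type}

/-- The `L`-module `ℝ^ι ⊕ ℂ^κ`, with trivial action on `ℝ^ι` and `x : L` acting on the `j`-th
coordinate of `ℂ^κ` by the infinitesimal rotation `i χ_j(x)`. -/
def RotModule (ι : Type) (_χ : κ → LieAlgebra.LieCharacter ℝ L) : Type := (ι → ℝ) × (κ → ℂ)

namespace RotModule

variable (χ : κ → LieAlgebra.LieCharacter ℝ L)

instance : AddCommGroup (RotModule ι χ) := inferInstanceAs (AddCommGroup ((ι → ℝ) × (κ → ℂ)))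
noncomputable instance : Module ℝ (RotModule ι χ) :=
  inferInstanceAs (Module ℝ ((ι → ℝ) × (κ → ℂ)))
instance [Finite ι] [Finite κ] : FiniteDimensional ℝ (RotModule ι χ) :=
  inferInstanceAs (FiniteDimensional ℝ ((ι → ℝ) × (κ → ℂ)))

/-- The coordinates of the trivial summand `ℝ^ι`. -/
noncomputable def real (i : ι) : RotModule ι χ →ₗ[ℝ] ℝ :=
  LinearMap.proj i ∘ₗ LinearMap.fst ℝ (ι → ℝ) (κ → ℂ)

/-- The coordinates of the rotating summand `ℂ^κ`. -/
noncomputable def complex (j : κ) : RotModule ι χ →ₗ[ℝ] ℂ :=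
  LinearMap.proj j ∘ₗ LinearMap.snd ℝ (ι → ℝ) (κ → ℂ)

/-- The inclusion of the trivial summand `ℝ^ι`. -/
noncomputable def ofReal : (ι → ℝ) →ₗ[ℝ] RotModule ι χ := LinearMap.inl ℝ (ι → ℝ) (κ → ℂ)

/-- The inclusion of the rotating summand `ℂ^κ`. -/
noncomputable def ofComplex : (κ → ℂ) →ₗ[ℝ] RotModule ι χ := LinearMap.inr ℝ (ι → ℝ) (κ → ℂ)

variable {χ}

theorem ext {a b : RotModule ι χ} (hr : ∀ i, real χ i a = real χ i b)
    (hc : ∀ j, complex χ j a = complex χ j b) : a = b :=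
  Prod.ext (funext hr) (funext hc)

@[simp] theorem real_ofReal (i : ι) (v : ι → ℝ) : real χ i (ofReal χ v) = v i := rfl
@[simp] theorem complex_ofReal (j : κ) (v : ι → ℝ) : complex χ j (ofReal χ v) = 0 := rfl
@[simp] theorem real_ofComplex (i : ι) (w : κ → ℂ) : real χ i (ofComplex χ w) = 0 := rfl
@[simp] theorem complex_ofComplex (j : κ) (w : κ → ℂ) :
    complex χ j (ofComplex (ι := ι) χ w) = w j := rfl

noncomputable instance : Bracket L (RotModule ι χ) where
  bracket x a := ofComplex χ fun j => χ j x * Complex.I * complex χ j a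

@[simp] theorem real_lie (i : ι) (x : L) (a : RotModule ι χ) : real χ i ⁅x, a⁆ = 0 := rfl
@[simp] theorem complex_lie (j : κ) (x : L) (a : RotModule ι χ) :
    complex χ j ⁅x, a⁆ = χ j x * Complex.I * complex χ j a := rfl

noncomputable instance : LieRingModule L (RotModule ι χ) where
  add_lie x y a := ext (by simp) fun j => by
    simp only [complex_lie, map_add, Complex.ofReal_add]
    ring
  lie_add x a b := ext (by simp) fun j => by
    simp only [complex_lie, map_add]
    ring
  leibniz_lie x y a := ext (by simp) fun j => by
    simp only [complex_lie, map_add, LieHom.map_lie, LieAlgebra.lieCharacter_apply_lie',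
      Complex.ofReal_zero, zero_mul, zero_add]
    ring

instance : LieModule ℝ L (RotModule ι χ) where
  smul_lie r x a := ext (by simp) fun j => by
    simp only [complex_lie, map_smul, smul_eq_mul, Complex.ofReal_mul, Complex.real_smul]
    ring
  lie_smul r x a := ext (by simp) fun j => by
    simp only [complex_lie, map_smul, Complex.real_smul]
    ring

theorem lie_ofReal (x : L) (v : ι → ℝ) : ⁅x, ofReal χ v⁆ = 0 := ext (by simp) (by simp)

theorem apply_eq_zero_of_mem_ker {x : L} (hx : x ∈ LieModule.ker ℝ L (RotModule ι χ)) (j : κ) :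
    χ j x = 0 := by
  have h := congrArg (complex χ j) ((LieModule.mem_ker ℝ L _ x).1 hx (ofComplex χ fun _ => 1))
  simpa using h

theorem apply_eq_zero_of_mem_centralPart {k : ℕ} {x : L}
    (hx : x ∈ centralPart L (RotModule ι χ) k) (j : κ) : χ j x = 0 := by
  cases k with
  | zero => exact apply_eq_zero_of_mem_ker hx.2 j
  | succ k =>
    exact apply_eq_zero_of_mem_lowerCentralSeries_one (θ := (χ j : L →ₗ[ℝ] ℝ))
      (LieAlgebra.lieCharacter_apply_lie (χ j))
      (LieModule.antitone_lowerCentralSeries ℝ L L (Nat.le_add_left 1 k) hx.2)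

variable [Fintype ι] [Fintype κ]

/-- The inner product `diag ε` on `ℝ^ι`, extended by the standard one on `ℂ^κ`. -/
noncomputable def form (χ : κ → LieAlgebra.LieCharacter ℝ L) (ε : ι → ℝ) :
    LinearMap.BilinForm ℝ (RotModule ι χ) :=
  ∑ i, ε i • (LinearMap.mul ℝ ℝ).compl₁₂ (real χ i) (real χ i) +
    ∑ j, (innerₗ ℂ).compl₁₂ (complex χ j) (complex χ j)

theorem form_apply (ε : ι → ℝ) (a b : RotModule ι χ) :
    form χ ε a b = ∑ i, ε i * (real χ i a * real χ i b) +
      ∑ j, inner ℝ (complex χ j a) (complex χ j b) := by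
  simp [form]

theorem isSymm_form (ε : ι → ℝ) : (form χ ε).IsSymm := ⟨fun a b => by
  simp only [form_apply, mul_comm (real χ _ a), real_inner_comm]⟩

theorem form_lie_add_form_lie (ε : ι → ℝ) (x : L) (a b : RotModule ι χ) :
    form χ ε ⁅x, a⁆ b + form χ ε a ⁅x, b⁆ = 0 := by
  simp only [form_apply, real_lie, complex_lie, zero_mul, mul_zero, Finset.sum_const_zero,
    zero_add, ← Finset.sum_add_distrib, Complex.inner]
  refine Finset.sum_eq_zero fun j _ => ?_
  simp only [map_mul, Complex.conj_ofReal, Complex.conj_I, mul_neg, neg_mul, Complex.neg_re,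
    Complex.mul_re, Complex.ofReal_re, Complex.I_re, mul_zero, Complex.ofReal_im, Complex.I_im,
    mul_one, sub_self, Complex.conj_re, zero_mul, Complex.mul_im, add_zero, Complex.conj_im,
    sub_neg_eq_add, zero_add, neg_zero, neg_sub, zero_sub]
  ring

theorem form_ofReal (ε : ι → ℝ) (a : RotModule ι χ) (v : ι → ℝ) :
    form χ ε a (ofReal χ v) = ∑ i, ε i * (real χ i a * v i) := by
  simp [form_apply]

theorem real_eq_zero {ε : ι → ℝ} (hε : ∀ i, ε i ≠ 0) {a : RotModule ι χ}
    (ha : ∀ v, form χ ε a (ofReal χ v) = 0) (i : ι) : real χ i a = 0 := by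
  classical
  simpa [form_ofReal, Pi.single_apply, hε i] using ha (Pi.single i 1)

theorem form_nondegenerate {ε : ι → ℝ} (hε : ∀ i, ε i ≠ 0) : (form χ ε).Nondegenerate := by
  classical
  have left {a : RotModule ι χ} (ha : ∀ b, form χ ε a b = 0) : a = 0 := by
    refine ext (fun i => real_eq_zero hε (fun v => ha _) i) fun j => ?_
    have h := ha (ofComplex χ (Pi.single j (complex χ j a)))
    simp only [form_apply, real_ofComplex, complex_ofComplex, mul_zero, Finset.sum_const_zero,
      zero_add, Pi.single_apply, apply_ite (inner ℝ _), inner_zero_right, Finset.sum_ite_eq',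
      Finset.mem_univ, if_true] at h
    exact inner_self_eq_zero.1 h
  exact ⟨fun _ => left, fun _ ha => left fun b => ((isSymm_form ε).eq _ _).trans (ha b)⟩

theorem eq_zero_of_form_one_self {a : RotModule ι χ} (ha : form χ 1 a a = 0) : a = 0 := by
  have hr (i : ι) : 0 ≤ real χ i a * real χ i a := mul_self_nonneg _
  have hc (j : κ) : 0 ≤ inner ℝ (complex χ j a) (complex χ j a) := real_inner_self_nonneg
  simp only [form_apply, Pi.one_apply, one_mul] at ha
  rw [add_eq_zero_iff_of_nonneg (Finset.sum_nonneg fun i _ => hr i)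
    (Finset.sum_nonneg fun j _ => hc j), Finset.sum_eq_zero_iff_of_nonneg fun i _ => hr i,
    Finset.sum_eq_zero_iff_of_nonneg fun j _ => hc j] at ha
  exact ext (fun i => mul_self_eq_zero.1 (ha.1 i (Finset.mem_univ i)))
    fun j => inner_self_eq_zero.1 (ha.2 j (Finset.mem_univ j))

theorem isSemisimpleOrthogonalModule {ε : ι → ℝ} (hε : ∀ i, ε i ≠ 0) :
    IsSemisimpleOrthogonalModule L (RotModule ι χ) (form χ ε) where
  finiteDimensional := inferInstance
  symm := isSymm_form ε
  nondegenerate := form_nondegenerate hε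
  skew := form_lie_add_form_lie ε
  semisimple := complementedLattice_of_anisotropic (isSymm_form 1).isRefl
    (form_lie_add_form_lie 1) fun _ => eq_zero_of_form_one_self

end RotModule
end RotationModule

section Criterion

variable {L : Type*} [LieRing L] [LieAlgebra ℝ L]

variable (L) in
/-- A quadratic 2-cocycle of `L` with coefficients in the trivial module `ℝ^ι` with inner product
`diag ε`, given by the components of `α`. -/
structure DiagCocycle (ι : Type) [Fintype ι] where
  α : ι → LinearMap.BilinForm ℝ L
  isAlt : ∀ i, (α i).IsAlt
  γ : L [⋀^Fin 3]→ₗ[ℝ] ℝ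
  ε : ι → ℝ
  ε_ne_zero : ∀ i, ε i ≠ 0
  cyclic : ∀ i x y z, α i ⁅x, y⁆ z + α i ⁅y, z⁆ x + α i ⁅z, x⁆ y = 0
  d_γ : ∀ w x y z, dThree γ w x y z =
    ∑ i, ε i * (α i w x * α i y z - α i w y * α i x z + α i w z * α i x y)

variable (L) in
attribute [local instance] LieRing.ofAssociativeRing in
/-- The `j`-th coordinate of the summand `ℝ^k`, as a character of `L × ℝ^k`. -/
def rabCharacter {k : ℕ} (j : Fin k) : LieAlgebra.LieCharacter ℝ (L × Rab k) where
  toLinearMap := LinearMap.proj (φ := fun _ => ℝ) j ∘ₗ LinearMap.snd ℝ L (Rab k)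
  map_lie' {x y} := (sub_eq_zero.2 (mul_comm (x.2 j) (y.2 j))).symm

namespace DiagCocycle

variable {ι : Type} [Fintype ι]

/-- The pullback of a cocycle along a homomorphism of Lie algebras. -/
def comap (c : DiagCocycle L ι) {L' : Type*} [LieRing L'] [LieAlgebra ℝ L'] (φ : L' →ₗ⁅ℝ⁆ L) :
    DiagCocycle L' ι where
  α i := (c.α i).compl₁₂ (φ : L' →ₗ[ℝ] L) (φ : L' →ₗ[ℝ] L)
  isAlt i x := c.isAlt i (φ x)
  γ := c.γ.compLinearMap (φ : L' →ₗ[ℝ] L)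
  ε := c.ε
  ε_ne_zero := c.ε_ne_zero
  cyclic i x y z := by simpa using c.cyclic i (φ x) (φ y) (φ z)
  d_γ w x y z := by
    simpa only [dThree, compLinearMap_apply_three, LinearMap.compl₁₂_apply, LieHom.coe_toLinearMap,
      LieHom.map_lie] using c.d_γ (φ w) (φ x) (φ y) (φ z)

/-- The central elements that pair trivially with `L` under `α`, and under `γ` with the kernels of
bracket and `α` on `L × l^{m+1}`: the obstruction to conditions `(A_k)`, `k ≤ m`, up to the action
of `L` on the module. -/
def radical (c : DiagCocycle L ι) (m : ℕ) : Set L :=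
  {g | (∀ x : L, ⁅x, g⁆ = 0) ∧ (∀ i x, c.α i x g = 0) ∧
    ∀ x, ∀ y ∈ LieModule.lowerCentralSeries ℝ L L m, ⁅x, y⁆ = 0 → (∀ i, c.α i x y = 0) →
      c.γ ![x, g, y] = 0}

/-- Every vector of `ℝ^ι` is a value of `α` on a commuting pair in `L × l^{m+1}`. -/
def IsFull (c : DiagCocycle L ι) (m : ℕ) : Prop :=
  ∀ v : ι → ℝ, ∃ x, ∃ y ∈ LieModule.lowerCentralSeries ℝ L L m, ⁅x, y⁆ = 0 ∧
    ∀ i, c.α i x y = v i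

section Prod

variable {L' : Type*} [LieRing L'] [LieAlgebra ℝ L'] {κ : Type} [Fintype κ] {c : DiagCocycle L ι}
  {c' : DiagCocycle L' κ} {m : ℕ}

/-- The orthogonal sum of two cocycles, on the product of the Lie algebras. -/
noncomputable def prod (c : DiagCocycle L ι) (c' : DiagCocycle L' κ) :
    DiagCocycle (L × L') (ι ⊕ κ) where
  α := Sum.elim (c.comap (LieHom.fst ℝ L L')).α (c'.comap (LieHom.snd ℝ L L')).α
  isAlt := Sum.rec (c.comap (LieHom.fst ℝ L L')).isAlt (c'.comap (LieHom.snd ℝ L L')).isAlt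
  γ := (c.comap (LieHom.fst ℝ L L')).γ + (c'.comap (LieHom.snd ℝ L L')).γ
  ε := Sum.elim c.ε c'.ε
  ε_ne_zero := Sum.rec c.ε_ne_zero c'.ε_ne_zero
  cyclic := Sum.rec (c.comap (LieHom.fst ℝ L L')).cyclic (c'.comap (LieHom.snd ℝ L L')).cyclic
  d_γ w x y z := by
    have h := congrArg₂ (· + ·) ((c.comap (LieHom.fst ℝ L L')).d_γ w x y z)
      ((c'.comap (LieHom.snd ℝ L L')).d_γ w x y z)
    rw [Fintype.sum_sum_type]
    refine Eq.trans ?_ h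
    simp only [dThree, AlternatingMap.add_apply]
    ring

theorem prod_γ_apply (u v w : L × L') :
    (c.prod c').γ ![u, v, w] = c.γ ![u.1, v.1, w.1] + c'.γ ![u.2, v.2, w.2] :=
  congrArg₂ (· + ·) (compLinearMap_apply_three c.γ (LieHom.fst ℝ L L' : L × L' →ₗ[ℝ] L) u v w)
    (compLinearMap_apply_three c'.γ (LieHom.snd ℝ L L' : L × L' →ₗ[ℝ] L') u v w)

theorem fst_mem_radical {g : L × L'} (hg : g ∈ (c.prod c').radical m) : g.1 ∈ c.radical m := by
  refine ⟨fun x => congrArg Prod.fst (hg.1 (x, 0)), fun i x => hg.2.1 (.inl i) (x, 0),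
    fun x y hy hxy hα => ?_⟩
  have h := hg.2.2 (x, 0) (y, 0) (inl_mem_lowerCentralSeries hy) (Prod.ext hxy (lie_zero 0))
    (Sum.rec hα fun i => map_zero (c'.α i 0))
  rwa [prod_γ_apply, c'.γ.map_coord_zero (i := 0) rfl, add_zero] at h

theorem snd_mem_radical {g : L × L'} (hg : g ∈ (c.prod c').radical m) : g.2 ∈ c'.radical m := by
  refine ⟨fun x => congrArg Prod.snd (hg.1 (0, x)), fun i x => hg.2.1 (.inr i) (0, x),
    fun x y hy hxy hα => ?_⟩
  have h := hg.2.2 (0, x) (0, y) (inr_mem_lowerCentralSeries hy) (Prod.ext (lie_zero 0) hxy)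
    (Sum.rec (fun i => map_zero (c.α i 0)) hα)
  rwa [prod_γ_apply, c.γ.map_coord_zero (i := 0) rfl, zero_add] at h

theorem IsFull.prod (h : c.IsFull m) (h' : c'.IsFull m) : (c.prod c').IsFull m := by
  intro v
  obtain ⟨x, y, hy, hxy, hv⟩ := h (v ∘ Sum.inl)
  obtain ⟨x', y', hy', hxy', hv'⟩ := h' (v ∘ Sum.inr)
  refine ⟨(x, x'), (y, y'), ?_, Prod.ext hxy hxy', Sum.rec hv hv'⟩
  simpa using add_mem (inl_mem_lowerCentralSeries (L' := L') hy)
    (inr_mem_lowerCentralSeries (L := L) hy')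

end Prod

variable (c : DiagCocycle L ι) {κ : Type} (χ : κ → LieAlgebra.LieCharacter ℝ L)

/-- The 2-cochain `α`, with values in the trivial summand of `RotModule ι χ`. -/
noncomputable def toTwoCochain : twoCochain ℝ L (RotModule ι χ) :=
  ⟨LinearMap.mk₂ ℝ (fun x y => RotModule.ofReal χ fun i => c.α i x y)
      (fun _ _ _ => RotModule.ext (by simp) (by simp))
      (fun _ _ _ => RotModule.ext (by simp) (by simp))
      (fun _ _ _ => RotModule.ext (by simp) (by simp))
      (fun _ _ _ => RotModule.ext (by simp) (by simp)),
    fun x => RotModule.ext (fun i => c.isAlt i x) (by simp)⟩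

theorem toTwoCochain_apply (x y : L) :
    c.toTwoCochain χ x y = RotModule.ofReal χ fun i => c.α i x y := rfl

variable [Fintype κ]

/-- The quadratic cocycle `(α, γ)`, with values in the trivial summand of `RotModule ι χ`. -/
noncomputable def toQuadCocycle : QuadCocycle L (RotModule.form χ c.ε) where
  α := c.toTwoCochain χ
  γ := c.γ
  d_α := by
    ext x y z
    rw [d₂₃_apply]
    simp only [toTwoCochain_apply, RotModule.lie_ofReal, sub_zero, zero_add, zero_sub]
    refine RotModule.ext (fun i => ?_) fun j => by simp
    have h := c.cyclic i x y z
    rw [← lie_skew z x, map_neg, LinearMap.neg_apply] at h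
    simp only [map_sub, map_add, map_neg, RotModule.real_ofReal, LinearMap.zero_apply, map_zero]
    linear_combination -h
  d_γ w x y z := by
    rw [c.d_γ, wedge₂₂]
    simp only [toTwoCochain_apply, RotModule.form_ofReal, RotModule.real_ofReal,
      ← Finset.sum_add_distrib, ← Finset.sum_sub_distrib, Finset.mul_sum]
    exact Finset.sum_congr rfl fun i _ => by ring

theorem conditionB {m : ℕ} (hB : c.IsFull m) {k : ℕ} (hk : k ≤ m) :
    ConditionB (c.toQuadCocycle χ) k := by
  set W := (LinearMap.ker (bracketMap L k)).map (cochainMap (c.toQuadCocycle χ).α k)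
  have hle := LieModule.antitone_lowerCentralSeries ℝ L L hk
  have ofReal_mem (v : ι → ℝ) : RotModule.ofReal χ v ∈ W := by
    obtain ⟨x, y, hy, hxy, hv⟩ := hB v
    exact ⟨x ⊗ₜ ⟨y, hle hy⟩, hxy, congrArg (RotModule.ofReal χ) (funext hv)⟩
  have complex_eq_zero {a : RotModule ι χ} (ha : a ∈ W) (j : κ) : RotModule.complex χ j a = 0 := by
    obtain ⟨t, -, rfl⟩ := ha
    induction t using TensorProduct.induction_on with
    | zero => rw [map_zero, map_zero]
    | add t t' ht ht' => rw [map_add, map_add, ht, ht', add_zero]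
    | tmul x y => rfl
  have left {a : W} (ha : ∀ b : W, RotModule.form χ c.ε a b = 0) : a = 0 :=
    Subtype.ext <| RotModule.ext
      (RotModule.real_eq_zero c.ε_ne_zero fun v => ha ⟨_, ofReal_mem v⟩) (complex_eq_zero a.2)
  exact ⟨fun _ => left, fun _ ha => left fun b =>
    ((RotModule.isSymm_form c.ε).eq _ _).trans (ha b)⟩

theorem conditionA {m : ℕ} (hA : ∀ g ∈ c.radical m, (∀ j, χ j g = 0) → g = 0) {k : ℕ}
    (hk : k ≤ m) : ConditionA (c.toQuadCocycle χ) k := by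
  intro g hg ⟨A₀, Z₀, hgxy⟩
  refine hA g ⟨?_, fun i x => congrArg (RotModule.real χ i) (hgxy x).1, fun x y hy hxy hαxy => ?_⟩
    (RotModule.apply_eq_zero_of_mem_centralPart hg)
  · cases k <;> exact hg.1
  · let y' : LieModule.lowerCentralSeries ℝ L L k :=
      ⟨y, LieModule.antitone_lowerCentralSeries ℝ L L hk hy⟩
    have hα : (c.toQuadCocycle χ).α x (y' : L) = 0 := RotModule.ext hαxy fun j => rfl
    have hxy' : ⁅x, y'⁆ = 0 := Subtype.ext hxy
    rw [← neg_zero, ← map_zero (RotModule.form χ c.ε A₀), ← hα, ← add_zero (-_),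
      ← map_zero Z₀, ← hxy']
    exact (hgxy x).2 y'

omit [Fintype κ] in
theorem isAdmissible [Finite κ] {m : ℕ} (hm : LieModule.lowerCentralSeries ℝ L L (m + 1) = ⊥)
    (hA : ∀ g ∈ c.radical m, (∀ j, χ j g = 0) → g = 0) (hB : c.IsFull m) : IsAdmissible L := by
  cases nonempty_fintype κ
  exact ⟨RotModule ι χ, inferInstance, inferInstance, inferInstance, inferInstance,
    RotModule.form χ c.ε, RotModule.isSemisimpleOrthogonalModule c.ε_ne_zero,
    Quotient.mk _ (c.toQuadCocycle χ), c.toQuadCocycle χ, rfl,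
    fun _ _ _ => RotModule.lie_ofReal _ _,
    m, hm, fun _ hk => ⟨c.conditionA χ hA hk, c.conditionB χ hB hk⟩⟩

theorem isAdmissible_prod_rab {m : ℕ} (hm : LieModule.lowerCentralSeries ℝ L L (m + 1) = ⊥)
    (hA : ∀ g ∈ c.radical m, g = 0) (hB : c.IsFull m) (k : ℕ) : IsAdmissible (L × Rab k) := by
  refine (c.comap (LieHom.fst ℝ L (Rab k))).isAdmissible (rabCharacter L) (m := m) ?_ ?_ ?_
  · refine (LieSubmodule.eq_bot_iff _).2 fun u hu => Prod.ext ?_ ?_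
    · have h := LieIdeal.map_lowerCentralSeries_le (m + 1)
        (LieIdeal.mem_map (f := LieHom.fst ℝ L (Rab k)) hu)
      rwa [hm] at h
    · exact apply_eq_zero_of_mem_lowerCentralSeries_succ (θ := LinearMap.snd ℝ L (Rab k))
        (fun _ _ _ => rfl) hu
  · rintro ⟨g, r⟩ ⟨hg, hαg, hγg⟩ hr
    refine Prod.ext (hA g ⟨fun x => congrArg Prod.fst (hg (x, 0)), fun i x => hαg i (x, 0),
      fun x y hy hxy hαxy => ?_⟩) (funext hr)
    exact (compLinearMap_apply_three _ _ _ _ _).symm.trans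
      (hγg (x, 0) (y, 0) (inl_mem_lowerCentralSeries hy) (Prod.ext hxy rfl) hαxy)
  · intro v
    obtain ⟨x, y, hy, hxy, hv⟩ := hB v
    exact ⟨(x, 0), (y, 0), inl_mem_lowerCentralSeries hy, Prod.ext hxy rfl, hv⟩

end DiagCocycle
end Criterion

section Examples

namespace G41

/-- The basis `X₁, X₂, Y, Z` of `g_{4,1}`. -/
noncomputable def basis : Basis (Fin 4) ℝ G41 := Pi.basisFun ℝ (Fin 4)

theorem repr_lie (x y : G41) : ⇑(basis.repr ⁅x, y⁆) = br (basis.repr x) (basis.repr y) := rfl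

/-- The cocycle with `α = X₁* ∧ Y*` and `γ = 0`. -/
noncomputable def cocycle : DiagCocycle G41 Unit where
  α _ := wedge (basis.coord 0) (basis.coord 2)
  isAlt _ := isAlt_wedge _ _
  γ := 0
  ε := 1
  ε_ne_zero _ := one_ne_zero
  cyclic _ x y z := by
    simp only [wedge_apply, Basis.coord_apply, repr_lie, br, minor, Matrix.cons_val_zero, zero_mul,
      Matrix.cons_val, zero_sub]
    ring
  d_γ w x y z := by
    simp only [dThree, AlternatingMap.zero_apply, neg_zero, add_zero, sub_self, Finset.univ_unique,
      Pi.one_apply, wedge_apply, Basis.coord_apply, one_mul, Finset.sum_const,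
      Finset.card_singleton, smul_add, one_smul]
    ring

theorem lie_lie_lie_lie (w x y z : G41) : ⁅w, ⁅x, ⁅y, z⁆⁆⁆ = 0 :=
  basis.ext_elem fun i => by fin_cases i <;> simp [repr_lie, br, minor]

theorem eq_zero_of_mem_radical {g : G41} (hg : g ∈ cocycle.radical 2) : g = 0 := by
  have hlie (x : G41) : br (basis.repr x) (basis.repr g) = 0 := by
    rw [← repr_lie, hg.1, map_zero, Finsupp.coe_zero]
  refine basis.ext_elem fun i => ?_
  fin_cases i
  · simpa [br, minor] using congrFun (hlie (basis 1)) 3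
  · simpa [br, minor] using congrFun (hlie (basis 0)) 3
  · simpa [cocycle, wedge_apply] using hg.2.1 () (basis 0)
  · simpa [br, minor] using congrFun (hlie (basis 0)) 2

theorem basis_two_mem_lowerCentralSeries : basis 2 ∈ LieModule.lowerCentralSeries ℝ G41 G41 2 := by
  have h : basis 2 = ⁅basis 0, ⁅basis 0, basis 1⁆⁆ :=
    basis.ext_elem fun i => by fin_cases i <;> simp [repr_lie, br, minor]
  exact h ▸ LieSubmodule.lie_mem_lie (LieSubmodule.mem_top _) (lie_mem_lowerCentralSeries_one _ _)

theorem isFull_cocycle : cocycle.IsFull 2 := fun v =>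
  ⟨basis 0, v () • basis 2, Submodule.smul_mem _ _ basis_two_mem_lowerCentralSeries,
    basis.ext_elem fun i => by fin_cases i <;> simp [repr_lie, br, minor],
    fun _ => by simp [cocycle, wedge_apply]⟩

theorem isAdmissible_prod_rab (k : ℕ) : IsAdmissible (G41 × Rab k) :=
  cocycle.isAdmissible_prod_rab
    (lowerCentralSeries_three_eq_bot_of_lie_lie_lie_lie lie_lie_lie_lie)
    (fun _ => eq_zero_of_mem_radical) isFull_cocycle k

end G41

namespace G52

/-- The basis `X₁, X₂, X₃, Y, Z` of `g_{5,2}`. -/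
noncomputable def basis : Basis (Fin 5) ℝ G52 := Pi.basisFun ℝ (Fin 5)

theorem repr_lie (x y : G52) : ⇑(basis.repr ⁅x, y⁆) = br (basis.repr x) (basis.repr y) := rfl

/-- The cocycle with `α = (X₁* ∧ Y*, X₁* ∧ Z*)` and `γ = 0`. -/
noncomputable def cocycle : DiagCocycle G52 (Fin 2) where
  α := ![wedge (basis.coord 0) (basis.coord 3), wedge (basis.coord 0) (basis.coord 4)]
  isAlt i := by fin_cases i <;> exact isAlt_wedge _ _
  γ := 0
  ε := 1
  ε_ne_zero _ := one_ne_zero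
  cyclic i x y z := by
    fin_cases i <;>
      simp only [Fin.zero_eta, Matrix.cons_val_zero, wedge_apply, Basis.coord_apply, repr_lie, br,
        minor, zero_mul, Matrix.cons_val, zero_sub, Fin.mk_one, Matrix.cons_val_one,
        Matrix.cons_val_fin_one] <;> ring
  d_γ w x y z := by
    simp only [dThree, AlternatingMap.zero_apply, neg_zero, add_zero, sub_self, Pi.one_apply,
      one_mul, Fin.sum_univ_two, Matrix.cons_val_zero, wedge_apply, Basis.coord_apply,
      Matrix.cons_val_one, Matrix.cons_val_fin_one]
    ring

theorem lie_lie_lie (x y z : G52) : ⁅x, ⁅y, z⁆⁆ = 0 :=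
  basis.ext_elem fun i => by fin_cases i <;> simp [repr_lie, br, minor]

theorem eq_zero_of_mem_radical {g : G52} (hg : g ∈ cocycle.radical 1) : g = 0 := by
  have hlie (x : G52) : br (basis.repr x) (basis.repr g) = 0 := by
    rw [← repr_lie, hg.1, map_zero, Finsupp.coe_zero]
  refine basis.ext_elem fun i => ?_
  fin_cases i
  · simpa [br, minor] using congrFun (hlie (basis 1)) 3
  · simpa [br, minor] using congrFun (hlie (basis 0)) 3
  · simpa [br, minor] using congrFun (hlie (basis 0)) 4
  · simpa [cocycle, wedge_apply] using hg.2.1 0 (basis 0)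
  · simpa [cocycle, wedge_apply] using hg.2.1 1 (basis 0)

theorem isFull_cocycle : cocycle.IsFull 1 := fun v => by
  refine ⟨basis 0, ⁅basis 0, v 0 • basis 1 + v 1 • basis 2⁆, lie_mem_lowerCentralSeries_one _ _,
    lie_lie_lie _ _ _, fun i => ?_⟩
  fin_cases i <;> simp [cocycle, wedge_apply, repr_lie, br, minor]

theorem isAdmissible_prod_rab (k : ℕ) : IsAdmissible (G52 × Rab k) :=
  cocycle.isAdmissible_prod_rab (lowerCentralSeries_two_eq_bot_of_lie_lie_lie lie_lie_lie)
    (fun _ => eq_zero_of_mem_radical) isFull_cocycle k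

end G52

namespace G64

/-- The basis `X₁, X₂, X₃, X₄, Y, Z` of `g_{6,4}`. -/
noncomputable def basis : Basis (Fin 6) ℝ G64 := Pi.basisFun ℝ (Fin 6)

theorem repr_lie (x y : G64) : ⇑(basis.repr ⁅x, y⁆) = br (basis.repr x) (basis.repr y) := rfl

/-- The cocycle with `α = X₁* ∧ Z* + X₂* ∧ X₃*` and `γ = X₃* ∧ Y* ∧ Z*`. -/
noncomputable def cocycle : DiagCocycle G64 Unit where
  α _ := wedge (basis.coord 0) (basis.coord 5) + wedge (basis.coord 1) (basis.coord 2)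
  isAlt _ := (isAlt_wedge _ _).add (isAlt_wedge _ _)
  γ := tripleWedge (basis.coord 2) (basis.coord 4) (basis.coord 5)
  ε := 1
  ε_ne_zero _ := one_ne_zero
  cyclic _ x y z := by
    simp only [LinearMap.add_apply, wedge_apply, Basis.coord_apply, repr_lie, br, minor,
      Matrix.cons_val_zero, zero_mul, Matrix.cons_val, zero_sub, Matrix.cons_val_one, sub_self,
      add_zero]
    ring
  d_γ w x y z := by
    simp only [dThree, tripleWedge_apply, Basis.coord_apply, repr_lie, br, minor, Matrix.cons_val,
      wedge_apply, zero_mul, zero_sub, neg_add_rev, neg_neg, Finset.univ_unique, Pi.one_apply,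
      LinearMap.add_apply, one_mul, Finset.sum_const, Finset.card_singleton, smul_add, one_smul]
    ring

theorem lie_lie_lie (x y z : G64) : ⁅x, ⁅y, z⁆⁆ = 0 :=
  basis.ext_elem fun i => by fin_cases i <;> simp [repr_lie, br, minor]

theorem eq_zero_of_mem_radical {g : G64} (hg : g ∈ cocycle.radical 1) : g = 0 := by
  have hlie (x : G64) : br (basis.repr x) (basis.repr g) = 0 := by
    rw [← repr_lie, hg.1, map_zero, Finsupp.coe_zero]
  have hγ : cocycle.γ ![basis 2, g, ⁅basis 0, basis 2⁆] = 0 :=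
    hg.2.2 _ _ (lie_mem_lowerCentralSeries_one _ _) (lie_lie_lie _ _ _) fun _ => by
      simp [cocycle, wedge_apply, repr_lie, br, minor]
  refine basis.ext_elem fun i => ?_
  fin_cases i
  · simpa [br, minor] using congrFun (hlie (basis 2)) 5
  · simpa [br, minor] using congrFun (hlie (basis 0)) 4
  · simpa [br, minor] using congrFun (hlie (basis 0)) 5
  · simpa [br, minor] using congrFun (hlie (basis 2)) 4
  · simpa [cocycle, tripleWedge_apply, wedge_apply, repr_lie, br, minor] using hγ
  · simpa [cocycle, wedge_apply] using hg.2.1 () (basis 0)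

theorem isFull_cocycle : cocycle.IsFull 1 := fun v =>
  ⟨basis 0, ⁅basis 0, v () • basis 2⁆, lie_mem_lowerCentralSeries_one _ _, lie_lie_lie _ _ _,
    fun _ => by simp [cocycle, wedge_apply, repr_lie, br, minor]⟩

theorem isAdmissible_prod_rab (k : ℕ) : IsAdmissible (G64 × Rab k) :=
  cocycle.isAdmissible_prod_rab (lowerCentralSeries_two_eq_bot_of_lie_lie_lie lie_lie_lie)
    (fun _ => eq_zero_of_mem_radical) isFull_cocycle k

end G64

namespace G65

/-- The basis `X₁, X₂, X₃, X₄, Y, Z` of `g_{6,5}`. -/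
noncomputable def basis : Basis (Fin 6) ℝ G65 := Pi.basisFun ℝ (Fin 6)

theorem repr_lie (x y : G65) : ⇑(basis.repr ⁅x, y⁆) = br (basis.repr x) (basis.repr y) := rfl

/-- The cocycle with `α = (X₁* ∧ Y* + X₄* ∧ Z*, X₄* ∧ Y* - X₁* ∧ Z*)` and `γ = 0`, for the inner
product of signature `(1, 1)`. -/
noncomputable def cocycle : DiagCocycle G65 (Fin 2) where
  α := ![wedge (basis.coord 0) (basis.coord 4) + wedge (basis.coord 3) (basis.coord 5),
    wedge (basis.coord 3) (basis.coord 4) - wedge (basis.coord 0) (basis.coord 5)]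
  isAlt i := by
    fin_cases i
    · exact (isAlt_wedge _ _).add (isAlt_wedge _ _)
    · exact (isAlt_wedge _ _).sub (isAlt_wedge _ _)
  γ := 0
  ε := ![1, -1]
  ε_ne_zero i := by fin_cases i <;> simp
  cyclic i x y z := by
    fin_cases i <;>
      simp only [Fin.zero_eta, Matrix.cons_val_zero, LinearMap.add_apply, wedge_apply,
        Basis.coord_apply, repr_lie, br, minor, zero_mul, Matrix.cons_val, zero_sub, Fin.mk_one,
        Matrix.cons_val_one, Matrix.cons_val_fin_one, LinearMap.sub_apply, sub_neg_eq_add] <;> ring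
  d_γ w x y z := by
    simp only [dThree, AlternatingMap.zero_apply, neg_zero, add_zero, sub_self, Fin.sum_univ_two,
      Matrix.cons_val_zero, LinearMap.add_apply, wedge_apply, Basis.coord_apply, one_mul,
      Matrix.cons_val_one, Matrix.cons_val_fin_one, LinearMap.sub_apply, neg_mul, neg_add_rev,
      neg_sub]
    ring

theorem lie_lie_lie (x y z : G65) : ⁅x, ⁅y, z⁆⁆ = 0 :=
  basis.ext_elem fun i => by fin_cases i <;> simp [repr_lie, br, minor]

theorem eq_zero_of_mem_radical {g : G65} (hg : g ∈ cocycle.radical 1) : g = 0 := by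
  have hlie (x : G65) : br (basis.repr x) (basis.repr g) = 0 := by
    rw [← repr_lie, hg.1, map_zero, Finsupp.coe_zero]
  refine basis.ext_elem fun i => ?_
  fin_cases i
  · simpa [br, minor] using congrFun (hlie (basis 2)) 5
  · simpa [br, minor] using congrFun (hlie (basis 0)) 4
  · simpa [br, minor] using congrFun (hlie (basis 0)) 5
  · simpa [br, minor] using congrFun (hlie (basis 2)) 4
  · simpa [cocycle, wedge_apply] using hg.2.1 0 (basis 0)
  · simpa [cocycle, wedge_apply] using hg.2.1 1 (basis 0)

theorem isFull_cocycle : cocycle.IsFull 1 := fun v => by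
  refine ⟨basis 0, ⁅basis 0, v 0 • basis 1 - v 1 • basis 2⁆, lie_mem_lowerCentralSeries_one _ _,
    lie_lie_lie _ _ _, fun i => ?_⟩
  fin_cases i <;> simp [cocycle, wedge_apply, repr_lie, br, minor]

theorem isAdmissible_prod_rab (k : ℕ) : IsAdmissible (G65 × Rab k) :=
  cocycle.isAdmissible_prod_rab (lowerCentralSeries_two_eq_bot_of_lie_lie_lie lie_lie_lie)
    (fun _ => eq_zero_of_mem_radical) isFull_cocycle k

end G65

namespace H1

/-- The basis `X₁, X₂, Y` of `h(1)`. -/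
noncomputable def basis : Basis (Fin 3) ℝ H1 := Pi.basisFun ℝ (Fin 3)

theorem repr_lie (x y : H1) : ⇑(basis.repr ⁅x, y⁆) = br (basis.repr x) (basis.repr y) := rfl

/-- The cocycle with `α = X₁* ∧ Y*` and `γ = 0`. -/
noncomputable def cocycle : DiagCocycle H1 Unit where
  α _ := wedge (basis.coord 0) (basis.coord 2)
  isAlt _ := isAlt_wedge _ _
  γ := 0
  ε := 1
  ε_ne_zero _ := one_ne_zero
  cyclic _ x y z := by
    simp only [wedge_apply, Basis.coord_apply, repr_lie, br, minor, Matrix.cons_val_zero, zero_mul,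
      Matrix.cons_val, zero_sub]
    ring
  d_γ w x y z := by
    simp only [dThree, AlternatingMap.zero_apply, neg_zero, add_zero, sub_self, Finset.univ_unique,
      Pi.one_apply, wedge_apply, Basis.coord_apply, one_mul, Finset.sum_const,
      Finset.card_singleton, smul_add, one_smul]
    ring

theorem lie_lie_lie (x y z : H1) : ⁅x, ⁅y, z⁆⁆ = 0 :=
  basis.ext_elem fun i => by fin_cases i <;> simp [repr_lie, br, minor]

theorem eq_zero_of_mem_radical {g : H1} (hg : g ∈ cocycle.radical 1) : g = 0 := by
  have hlie (x : H1) : br (basis.repr x) (basis.repr g) = 0 := by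
    rw [← repr_lie, hg.1, map_zero, Finsupp.coe_zero]
  refine basis.ext_elem fun i => ?_
  fin_cases i
  · simpa [br, minor] using congrFun (hlie (basis 1)) 2
  · simpa [br, minor] using congrFun (hlie (basis 0)) 2
  · simpa [cocycle, wedge_apply] using hg.2.1 () (basis 0)

theorem isFull_cocycle : cocycle.IsFull 1 := fun v =>
  ⟨basis 0, ⁅basis 0, v () • basis 1⁆, lie_mem_lowerCentralSeries_one _ _, lie_lie_lie _ _ _,
    fun _ => by simp [cocycle, wedge_apply, repr_lie, br, minor]⟩

theorem isAdmissible_prod_prod_rab (k : ℕ) : IsAdmissible ((H1 × H1) × Rab k) :=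
  (cocycle.prod cocycle).isAdmissible_prod_rab
    (lowerCentralSeries_two_eq_bot_of_lie_lie_lie fun x y z =>
      Prod.ext (lie_lie_lie x.1 y.1 z.1) (lie_lie_lie x.2 y.2 z.2))
    (fun _ hg => Prod.ext (eq_zero_of_mem_radical (DiagCocycle.fst_mem_radical hg))
      (eq_zero_of_mem_radical (DiagCocycle.snd_mem_radical hg)))
    (isFull_cocycle.prod isFull_cocycle) k

end H1

end Examples

end QuadLie

theorem proposition2 :
    (∀ (L : Type*) [LieRing L] [LieAlgebra ℝ L] [FiniteDimensional ℝ L] [LieRing.IsNilpotent L],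
      QuadLie.IsAdmissible L →
      Module.finrank ℝ (LieModule.lowerCentralSeries ℝ L L 1) = 2 →
      ∃ k : ℕ,
        Nonempty (L ≃ₗ⁅ℝ⁆ (QuadLie.H1 × QuadLie.H1) × QuadLie.Rab k) ∨
        Nonempty (L ≃ₗ⁅ℝ⁆ QuadLie.G41 × QuadLie.Rab k) ∨
        Nonempty (L ≃ₗ⁅ℝ⁆ QuadLie.G52 × QuadLie.Rab k) ∨
        Nonempty (L ≃ₗ⁅ℝ⁆ QuadLie.G64 × QuadLie.Rab k) ∨
        Nonempty (L ≃ₗ⁅ℝ⁆ QuadLie.G65 × QuadLie.Rab k)) ∧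
    (∀ k : ℕ,
      QuadLie.IsAdmissible ((QuadLie.H1 × QuadLie.H1) × QuadLie.Rab k) ∧
      QuadLie.IsAdmissible (QuadLie.G41 × QuadLie.Rab k) ∧
      QuadLie.IsAdmissible (QuadLie.G52 × QuadLie.Rab k) ∧
      QuadLie.IsAdmissible (QuadLie.G64 × QuadLie.Rab k) ∧
      QuadLie.IsAdmissible (QuadLie.G65 × QuadLie.Rab k)) := by
  refine ⟨fun L _ _ _ _ h hd => h.isListed hd, fun k => ⟨?_, ?_, ?_, ?_, ?_⟩⟩
  · exact QuadLie.H1.isAdmissible_prod_prod_rab k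
  · exact QuadLie.G41.isAdmissible_prod_rab k
  · exact QuadLie.G52.isAdmissible_prod_rab k
  · exact QuadLie.G64.isAdmissible_prod_rab k
  · exact QuadLie.G65.isAdmissible_prod_rab k
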